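/- Let $n \ge 0$ and let $F_n$ be the free group of rank $n$. A splitting of $F_n$ is a minimal action, without inversions, of $F_n$ by simplicial automorphisms on a simplicial tree (minimal: there is no proper invariant subtree), up to equivariant isomorphism. It is a $k$-edge splitting if there are exactly $k$ orbits of edges, a free splitting if all edge stabilizers are trivial, and a $\mathbb Z$-splitting if all edge stabilizers are infinite cyclic. Two free splittings $X$, $Y$ have a common refinement if there are a two-edge free splitting $R$ and collapse maps $R \to X$ and $R \to Y$, i.e. equivariant simplicial maps (edges go to edges or to vertices) such that the preimage of every point is connected. A splitting $T'$ is obtained from a free splitting $T$ by an edge fold if there are an edge $e$ of $T$, an endpoint $v$ of $e$ and an element $w$ of the stabilizer of $v$ such that $T'$ is the quotient of $T$ by the identification, for all $\gamma \in F_n$, of $\gamma e$ with all edges in its orbit under $\langle \gamma w \gamma^{-1}\rangle$. Let $FZ_n$ be the graph (the 1-skeleton of the cyclic splitting complex) whose vertices are the one-edge free splittings of $F_n$, where two distinct vertices $X$, $Y$ are joined by an edge if they have a common refinement or if there is a one-edge $\mathbb Z$-splitting $T$ obtained from $X$ by an edge fold and from $Y$ by an edge fold. Let $\overline{FZ}_n$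 be the graph whose vertices are the one-edge free splittings and the one-edge $\mathbb Z$-splittings of $F_n$, where two distinct vertices are joined by an edge if both are free splittings and they have a common refinement, or if one of them is obtained from the other by an edge fold. The group $\mathrm{Out}(F_n)$ acts on both vertex sets by precomposing actions with (inverses of) automorphisms. Then $FZ_n$ and $\overline{FZ}_n$ are $\mathrm{Out}(F_n)$-equivariantly quasi-isometric: there are an $\mathrm{Out}(F_n)$-equivariant map $\phi \colon V(FZ_n) \to V(\overline{FZ}_n)$ and constants $K \ge 1$, $C \ge 0$ such that, for the path metrics (with value $\infty$ between different components), $d(\phi(X),\phi(Y)) \le K\,d(X,Y) + C$ and $d(X,Y) \le K\, d(\phi(X),\phi(Y)) + C$ for all $X, Y \in V(FZ_n)$, and every vertex of $\overline{FZ}_n$ is at distance at most $C$ from some $\phi(X)$. -/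

import Mathlib

/-!
# One-edge splittings of a group and the two cyclic splitting complexes

Trees are simple graphs satisfying `SimpleGraph.IsTree`. A splitting of `G` is a minimal action of
`G` on a tree, by simplicial automorphisms and without inversions. Complexes are represented by
their 1-skeleta, which carry the path metric.
-/

open MulAction

/-- A minimal action of `G`, without inversions, on a simplicial tree (the Bass-Serre tree of a
graph-of-groups decomposition of `G`). The number of edges of the decomposition is not restricted
here. -/
structure Splitting (G : Type) [Group G] : Type 1 where
  /-- The vertices of the tree. -/
  V : Type
  /-- The tree. -/
  graph : SimpleGraph V
  /-- The action on vertices. -/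
  action : MulAction G V
  isTree : graph.IsTree
  adj_smul : ∀ (g : G) (x y : V), graph.Adj x y → graph.Adj (g • x) (g • y)
  no_inversion : ∀ (g : G) (x y : V), graph.Adj x y → ¬ (g • x = y ∧ g • y = x)
  /-- There is no proper invariant subtree. -/
  minimal : ∀ S : Set V, S.Nonempty → (∀ (g : G), ∀ x ∈ S, g • x ∈ S) →
    (graph.induce S).Connected → S = Set.univ

attribute [instance] Splitting.action

namespace Splitting

variable {G : Type} [Group G]

/-- Two edges of the tree are related if they lie in the same `G`-orbit. -/
def edgeSetoid (T : Splitting G) : Setoid T.graph.edgeSet where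
  r e e' := ∃ g : G, Sym2.map (fun x : T.V => g • x) e.1 = e'.1
  iseqv :=
    { refl := fun e => ⟨1, by simp⟩
      symm := by
        rintro e e' ⟨g, h⟩
        refine ⟨g⁻¹, ?_⟩
        rw [← h, Sym2.map_map]
        simp
      trans := by
        rintro e e' e'' ⟨g, h⟩ ⟨k, h'⟩
        refine ⟨k * g, ?_⟩
        rw [← h', ← h, Sym2.map_map]
        simp [mul_smul] }

/-- The number of `G`-orbits of edges, that is, the number of edges of the quotient graph of
groups (`0` if there are infinitely many). -/
noncomputable def numEdges (T : Splitting G) : ℕ := Nat.card (Quotient T.edgeSetoid)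

/-- The stabilizer of the edge joining `x` and `y` (there are no inversions). -/
def edgeStabilizer (T : Splitting G) (x y : T.V) : Subgroup G := stabilizer G x ⊓ stabilizer G y

/-- A free splitting: all edge stabilizers are trivial. -/
def IsFree (T : Splitting G) : Prop :=
  ∀ x y : T.V, T.graph.Adj x y → T.edgeStabilizer x y = ⊥

/-- All edge stabilizers are infinite cyclic. -/
def IsCyclic (T : Splitting G) : Prop :=
  ∀ x y : T.V, T.graph.Adj x y → Nonempty (T.edgeStabilizer x y ≃* Multiplicative ℤ)

/-- One-edge free splittings. -/
def IsOneEdgeFree (T : Splitting G) : Prop := T.numEdges = 1 ∧ T.IsFree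

/-- One-edge `ℤ`-splittings. -/
def IsOneEdgeCyclic (T : Splitting G) : Prop := T.numEdges = 1 ∧ T.IsCyclic

/-- Equivalence of splittings: an equivariant isomorphism of trees. -/
def Equivalent (T T' : Splitting G) : Prop :=
  ∃ f : T.graph ≃g T'.graph, ∀ (g : G) (x : T.V), f (g • x) = g • f x

/-- A collapse map, given by its values on vertices: it is equivariant, sends each edge to an edge
or to a vertex, and preimages of vertices and of interior points of edges are connected. -/
structure IsCollapseMap (T T' : Splitting G) (f : T.V → T'.V) : Prop where
  map_smul : ∀ (g : G) (x : T.V), f (g • x) = g • f x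
  map_adj : ∀ x y : T.V, T.graph.Adj x y → f x = f y ∨ T'.graph.Adj (f x) (f y)
  connected_preimage : ∀ p : T'.V, (T.graph.induce (f ⁻¹' {p})).Connected
  edge_unique : ∀ x y x' y' : T.V, T.graph.Adj x y → T.graph.Adj x' y' → f x ≠ f y →
    f x = f x' → f y = f y' → x = x' ∧ y = y'

/-- `X` and `Y` have a common refinement: a two-edge free splitting that collapses to both. -/
def HaveCommonRefinement (X Y : Splitting G) : Prop :=
  ∃ R : Splitting G, R.numEdges = 2 ∧ R.IsFree ∧
    (∃ f : R.V → X.V, IsCollapseMap R X f) ∧ (∃ f : R.V → Y.V, IsCollapseMap R Y f)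

/-- `T'` is obtained from the free splitting `T` by an equivariant edge fold: for some edge `e`
from `v` to `u` and some `w` fixing `v`, the tree `T'` is the quotient of `T` in which every
translate `γ e` is identified with its orbit under `⟨γ w γ⁻¹⟩`. Since `w` fixes `v`, the
identifications on vertices are generated by `γ u ∼ γ w ^ k u`. -/
def IsEdgeFold (T T' : Splitting G) : Prop :=
  T.IsFree ∧ ∃ (v u : T.V) (w : G) (f : T.V → T'.V),
    T.graph.Adj v u ∧ w ∈ stabilizer G v ∧
    (∀ (g : G) (x : T.V), f (g • x) = g • f x) ∧
    Function.Surjective f ∧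
    (∀ x y : T.V, f x = f y ↔
      Relation.EqvGen (fun a b => ∃ (γ : G) (k : ℤ), a = γ • u ∧ b = (γ * w ^ k) • u) x y) ∧
    (∀ p q : T'.V, T'.graph.Adj p q ↔ ∃ x y : T.V, T.graph.Adj x y ∧ f x = p ∧ f y = q)

theorem Equivalent.refl (T : Splitting G) : T.Equivalent T :=
  ⟨SimpleGraph.Iso.refl, fun _ _ => rfl⟩

theorem Equivalent.symm {T T' : Splitting G} (h : T.Equivalent T') : T'.Equivalent T := by
  obtain ⟨f, hf⟩ := h
  refine ⟨f.symm, fun g x => ?_⟩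
  apply f.injective
  rw [hf]
  simp

theorem Equivalent.trans {T T' T'' : Splitting G} (h : T.Equivalent T') (h' : T'.Equivalent T'') :
    T.Equivalent T'' := by
  obtain ⟨f, hf⟩ := h
  obtain ⟨k, hk⟩ := h'
  refine ⟨f.trans k, fun g x => ?_⟩
  change k (f (g • x)) = g • k (f x)
  rw [hf, hk]

/-- Equivalence of splittings as a setoid. -/
def setoid (G : Type) [Group G] : Setoid (Splitting G) :=
  ⟨Equivalent, Equivalent.refl, Equivalent.symm, Equivalent.trans⟩

/-- The splitting `φ • T`: the same tree, on which `g` acts as `φ⁻¹ g` acts on `T`. -/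
def twist (φ : MulAut G) (T : Splitting G) : Splitting G where
  V := T.V
  graph := T.graph
  action := MulAction.compHom T.V (φ⁻¹ : MulAut G).toMonoidHom
  isTree := T.isTree
  adj_smul g := T.adj_smul (φ⁻¹ g)
  no_inversion g := T.no_inversion (φ⁻¹ g)
  minimal S hS h := T.minimal S hS (fun g x hx => by
    have h1 : φ⁻¹ (φ g) • x ∈ S := h (φ g) x hx
    rwa [MulAut.inv_apply_self] at h1)

theorem twist_equivalent (φ : MulAut G) {T T' : Splitting G} (h : T.Equivalent T') :
    (twist φ T).Equivalent (twist φ T') := by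
  obtain ⟨f, hf⟩ := h
  exact ⟨f, fun g x => hf (φ⁻¹ g) x⟩

theorem twist_one (T : Splitting G) : (twist 1 T).Equivalent T :=
  ⟨SimpleGraph.Iso.refl, fun _ _ => rfl⟩

theorem twist_mul (φ ψ : MulAut G) (T : Splitting G) :
    (twist (φ * ψ) T).Equivalent (twist φ (twist ψ T)) := by
  have key : ∀ (g : G) (x : T.V), (φ * ψ)⁻¹ g • x = ψ⁻¹ (φ⁻¹ g) • x := fun g x => by
    rw [mul_inv_rev, MulAut.mul_apply]
  exact ⟨SimpleGraph.Iso.refl, key⟩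

theorem twist_conj (c : G) (T : Splitting G) : (twist (MulAut.conj c) T).Equivalent T := by
  have hadj : ∀ x y : T.V, T.graph.Adj (c • x) (c • y) ↔ T.graph.Adj x y := fun x y => by
    refine ⟨fun h => ?_, fun h => T.adj_smul c x y h⟩
    have h1 := T.adj_smul c⁻¹ _ _ h
    simpa using h1
  have key : ∀ (g : G) (x : T.V), c • ((MulAut.conj c)⁻¹ g • x) = g • c • x := fun g x => by
    rw [MulAut.conj_inv_apply, smul_smul, smul_smul]
    congr 1
    group
  let f : T.graph ≃g T.graph := ⟨MulAction.toPerm c, fun {x y} => hadj x y⟩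
  exact ⟨f, key⟩

theorem numEdges_twist (φ : MulAut G) (T : Splitting G) : (twist φ T).numEdges = T.numEdges := by
  have h : (twist φ T).edgeSetoid = T.edgeSetoid := by
    ext e e'
    constructor
    · rintro ⟨g, hg⟩
      exact ⟨φ⁻¹ g, hg⟩
    · rintro ⟨g, hg⟩
      refine ⟨φ g, ?_⟩
      have h2 : (fun x : T.V => φ⁻¹ (φ g) • x) = fun x : T.V => g • x := by
        rw [MulAut.inv_apply_self]
      change Sym2.map (fun x : T.V => φ⁻¹ (φ g) • x) e.1 = e'.1
      rw [h2]
      exact hg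
  unfold numEdges
  exact congrArg (fun s : Setoid T.graph.edgeSet => Nat.card (Quotient s)) h

theorem edgeStabilizer_twist (φ : MulAut G) (T : Splitting G) (x y : T.V) :
    (twist φ T).edgeStabilizer x y = (T.edgeStabilizer x y).map φ.toMonoidHom := by
  ext g
  have h1 : g ∈ (twist φ T).edgeStabilizer x y ↔ φ⁻¹ g ∈ T.edgeStabilizer x y := Iff.rfl
  rw [h1, Subgroup.mem_map]
  constructor
  · intro h
    exact ⟨φ⁻¹ g, h, MulAut.apply_inv_self G φ g⟩
  · rintro ⟨k, hk, rfl⟩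
    have h2 : φ⁻¹ (φ.toMonoidHom k) = k := MulAut.inv_apply_self G φ k
    rwa [h2]

theorem IsOneEdgeFree.twist {T : Splitting G} (h : T.IsOneEdgeFree) (φ : MulAut G) :
    (twist φ T).IsOneEdgeFree := by
  refine ⟨(numEdges_twist φ T).trans h.1, fun x y hxy => ?_⟩
  rw [edgeStabilizer_twist φ T x y, h.2 x y hxy, Subgroup.map_bot]

theorem IsOneEdgeCyclic.twist {T : Splitting G} (h : T.IsOneEdgeCyclic) (φ : MulAut G) :
    (twist φ T).IsOneEdgeCyclic := by
  refine ⟨(numEdges_twist φ T).trans h.1, fun x y hxy => ?_⟩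
  rw [edgeStabilizer_twist φ T x y]
  obtain ⟨e⟩ := h.2 x y hxy
  exact ⟨(MulEquiv.subgroupMap φ (T.edgeStabilizer x y)).symm.trans e⟩

end Splitting

/-- Equivalence classes of splittings of `G`. -/
abbrev SplittingClass (G : Type) [Group G] : Type 1 := Quotient (Splitting.setoid G)

/-- The class of a splitting. -/
abbrev Splitting.toClass {G : Type} [Group G] (T : Splitting G) : SplittingClass G :=
  Quotient.mk (Splitting.setoid G) T

instance innNormal (G : Type) [Group G] : (MulAut.conj (G := G)).range.Normal where
  conj_mem := by
    rintro _ ⟨c, rfl⟩ φ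
    refine ⟨φ c, ?_⟩
    ext x
    simp

/-- The outer automorphism group of `G`. -/
abbrev Out (G : Type) [Group G] : Type := MulAut G ⧸ (MulAut.conj (G := G)).range

section OutAction

variable {G : Type} [Group G]

instance SplittingClass.autAction : MulAction (MulAut G) (SplittingClass G) where
  smul φ := Quotient.map' (Splitting.twist φ) (fun _ _ h => Splitting.twist_equivalent φ h)
  one_smul c := Quotient.inductionOn c fun T => Quotient.sound (Splitting.twist_one T)
  mul_smul φ ψ c := Quotient.inductionOn c fun T => Quotient.sound (Splitting.twist_mul φ ψ T)

theorem SplittingClass.smul_toClass (φ : MulAut G) (T : Splitting G) :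
    φ • T.toClass = (Splitting.twist φ T).toClass := rfl

/-- `Out G` acts on classes of splittings, because inner automorphisms act trivially. -/
instance SplittingClass.outAction : MulAction (Out G) (SplittingClass G) :=
  MulAction.compHom (SplittingClass G)
    (QuotientGroup.lift (MulAut.conj (G := G)).range
      (MulAction.toPermHom (MulAut G) (SplittingClass G)) (by
        rintro _ ⟨c, rfl⟩
        refine Equiv.ext fun X => ?_
        exact Quotient.inductionOn X fun T => Quotient.sound (Splitting.twist_conj c T)))

theorem SplittingClass.mk_smul (φ : MulAut G) (T : Splitting G) :
    (QuotientGroup.mk φ : Out G) • T.toClass = (Splitting.twist φ T).toClass := rfl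

/-- A class of one-edge free splittings. -/
def SplittingClass.IsOneEdgeFree (X : SplittingClass G) : Prop :=
  ∃ T : Splitting G, T.toClass = X ∧ T.IsOneEdgeFree

/-- A class of one-edge `ℤ`-splittings. -/
def SplittingClass.IsOneEdgeCyclic (X : SplittingClass G) : Prop :=
  ∃ T : Splitting G, T.toClass = X ∧ T.IsOneEdgeCyclic

theorem SplittingClass.IsOneEdgeFree.smul {X : SplittingClass G} (h : X.IsOneEdgeFree)
    (a : Out G) : SplittingClass.IsOneEdgeFree (a • X) := by
  obtain ⟨T, rfl, hT⟩ := h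
  obtain ⟨φ, rfl⟩ := QuotientGroup.mk_surjective a
  exact ⟨Splitting.twist φ T, rfl, hT.twist φ⟩

theorem SplittingClass.IsOneEdgeCyclic.smul {X : SplittingClass G} (h : X.IsOneEdgeCyclic)
    (a : Out G) : SplittingClass.IsOneEdgeCyclic (a • X) := by
  obtain ⟨T, rfl, hT⟩ := h
  obtain ⟨φ, rfl⟩ := QuotientGroup.mk_surjective a
  exact ⟨Splitting.twist φ T, rfl, hT.twist φ⟩

end OutAction

/-- The vertices of `FZ`: classes of one-edge free splittings. -/
def FZVertex (G : Type) [Group G] : Type 1 := {X : SplittingClass G // X.IsOneEdgeFree}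

/-- The vertices of the second complex: classes of one-edge splittings which are free splittings
or `ℤ`-splittings. -/
def FZBarVertex (G : Type) [Group G] : Type 1 :=
  {X : SplittingClass G // X.IsOneEdgeFree ∨ X.IsOneEdgeCyclic}

instance FZVertex.outAction (G : Type) [Group G] : MulAction (Out G) (FZVertex G) where
  smul a X := ⟨a • X.1, X.2.smul a⟩
  one_smul X := Subtype.ext (one_smul _ X.1)
  mul_smul a b X := Subtype.ext (mul_smul a b X.1)

instance FZBarVertex.outAction (G : Type) [Group G] : MulAction (Out G) (FZBarVertex G) where
  smul a X := ⟨a • X.1, X.2.imp (fun h => h.smul a) (fun h => h.smul a)⟩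
  one_smul X := Subtype.ext (one_smul _ X.1)
  mul_smul a b X := Subtype.ext (mul_smul a b X.1)

/-- The 1-skeleton of the cyclic splitting complex. Distinct classes are adjacent if they have
representatives that admit a common refinement, or representatives from which one and the same
`ℤ`-splitting is obtained by edge folds. -/
def FZ (G : Type) [Group G] : SimpleGraph (FZVertex G) :=
  SimpleGraph.fromRel fun X Y => ∃ S T : Splitting G, S.toClass = X.1 ∧ T.toClass = Y.1 ∧
    (S.HaveCommonRefinement T ∨
      ∃ R : Splitting G, R.IsOneEdgeCyclic ∧ S.IsEdgeFold R ∧ T.IsEdgeFold R)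

/-- The 1-skeleton of the complex of one-edge free splittings and `ℤ`-splittings. Distinct classes
are adjacent if they have representatives that are free splittings with a common refinement, or
representatives one of which is obtained from the other by an edge fold. -/
def FZBar (G : Type) [Group G] : SimpleGraph (FZBarVertex G) :=
  SimpleGraph.fromRel fun X Y => ∃ S T : Splitting G, S.toClass = X.1 ∧ T.toClass = Y.1 ∧
    ((S.IsOneEdgeFree ∧ T.IsOneEdgeFree ∧ S.HaveCommonRefinement T) ∨ S.IsEdgeFold T)

/-- `f` is a quasi-isometry for the path metrics of the graphs `Γ` and `Δ`. The metrics take the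
value `⊤` between different components. -/
def IsQuasiIsometry {V W : Type*} (Γ : SimpleGraph V) (Δ : SimpleGraph W) (f : V → W) : Prop :=
  ∃ K C : ℕ, 1 ≤ K ∧
    (∀ x y : V, Δ.edist (f x) (f y) ≤ K * Γ.edist x y + C) ∧
    (∀ x y : V, Γ.edist x y ≤ K * Δ.edist (f x) (f y) + C) ∧
    (∀ z : W, ∃ x : V, Δ.edist z (f x) ≤ C)

/-! The quasi-isometry is the inclusion of vertex sets. A fold-type edge of `FZ` becomes a path of
length two through the common `ℤ`-splitting, and a refinement edge stays an edge, so distances grow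
at most by the factor 2. Conversely, every neighbor of a `ℤ`-splitting `Z` in `FZBar` is a free
splitting that folds to `Z`. Two successive free vertices around `Z` are therefore equal or adjacent
in `FZ`, and an edge fold between free splittings is trivial, so a path in `FZBar` between free
splittings shortcuts to one in `FZ` that is no longer.

What remains is coarse surjectivity: every one-edge `ℤ`-splitting `T` is an edge fold of a one-edge
free splitting (`Splitting.exists_isEdgeFold`). Mapping a subdivided Cayley tree to `T` gives a
resolution. Choose a resolution `S` with the fewest edge orbit representatives. It cannot be locally
injective, as its edge stabilizers are trivial and those of `T` are not. Two edges at a vertex with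
the same image must lie in one orbit, since otherwise folding them would lower the count. The
element relating them commutes with the whole cyclic stabilizer of the image edge, which therefore
fixes the common vertex: this is a `FoldEdge`.

Fold `S` along that edge. Minimality, now applied also after slides (`exists_fold_of_reachable`),
shows that the folded tree maps locally injectively to `T` (`FoldEdge.eqvGen_of_adj`), hence
injectively. So the folded tree is `T`, and `S` has a single orbit of edges.

Acyclicity is proved throughout with cuts: in a tree every set of edges is the boundary of a
two-coloring of the vertices, and such colorings pass to quotients and slides. -/

/-! ### Cuts, quotients and slides of trees -/

namespace SimpleGraph

variable {V W : Type*} {G : SimpleGraph V}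

/-- A graph is acyclic if every edge is the only edge crossing some cut. -/
theorem IsAcyclic.of_cuts (h : ∀ p q, G.Adj p q → ∃ χ : V → Bool, χ p ≠ χ q ∧
    ∀ x y, G.Adj x y → χ x ≠ χ y → s(x, y) = s(p, q)) : G.IsAcyclic := by
  rw [isAcyclic_iff_forall_adj_isBridge]
  intro p q hpq
  rw [isBridge_iff]
  rintro ⟨w⟩
  obtain ⟨χ, hne, hχ⟩ := h p q hpq
  apply hne
  clear hne hpq
  have key : ∀ {a b : V}, (G.deleteEdges {s(p, q)}).Walk a b → χ a = χ b := by
    intro a b w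
    induction w with
    | nil => rfl
    | cons hab _ ih =>
      rw [deleteEdges_adj] at hab
      rw [← ih]
      by_contra hne
      exact hab.2 (hχ _ _ hab.1 hne)
  exact key w

/-- In a tree every set of edges is the set of edges crossing some cut. -/
theorem IsTree.exists_cut (hG : G.IsTree) (E : Set (Sym2 V)) :
    ∃ χ : V → Bool, ∀ x y, G.Adj x y → (χ x ≠ χ y ↔ s(x, y) ∈ E) := by
  classical
  obtain ⟨o⟩ := hG.connected.nonempty
  choose P hP hP' using fun v => hG.existsUnique_path o v
  have hP0 : ∀ v, (P v).IsPath := hP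
  -- The color of a vertex is the parity of the number of edges of `E` on the path from the root.
  -- For adjacent vertices one of the two paths extends the other by their common edge.
  let χ : V → Bool := fun v => ((P v).edges.filter (· ∈ E)).length.bodd
  have concat : ∀ x y (h : G.Adj x y), P y = (P x).concat h → (χ x ≠ χ y ↔ s(x, y) ∈ E) := by
    intro x y h hy
    have h1 : (P y).edges = (P x).edges ++ [s(x, y)] := by
      rw [hy, Walk.edges_concat, List.concat_eq_append]
    simp only [χ, h1, List.filter_append, List.length_append, Nat.bodd_add]
    by_cases hE : s(x, y) ∈ E <;> simp [hE]
  refine ⟨χ, fun x y h => ?_⟩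
  by_cases hx : x ∈ (P y).support
  · exact concat x y h (hG.isAcyclic.path_concat (hP0 x) (hP0 y) h hx)
  · have hy := hG.isAcyclic.mem_support_of_ne_mem_support_of_adj_of_isPath (hP0 x) (hP0 y) h hx
    rw [ne_comm, concat y x h.symm (hG.isAcyclic.path_concat (hP0 y) (hP0 x) h.symm hy),
      Sym2.eq_swap]

/-- A locally injective homomorphism from a connected graph to an acyclic graph is injective. -/
theorem Connected.injective_of_locally_injective {H : SimpleGraph W} (hG : G.Connected)
    (hH : H.IsAcyclic) (f : G →g H)
    (hf : ∀ x y z, G.Adj x y → G.Adj x z → f y = f z → y = z) : Function.Injective f := by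
  classical
  -- In an acyclic graph, an image path that fails to be simple must backtrack immediately, and
  -- local injectivity excludes backtracking.
  have key : ∀ {x y : V} (p : G.Walk x y), p.IsPath → (p.map f).IsPath := by
    intro x y p
    induction p with
    | nil => simp
    | @cons u v w h p ih =>
      intro hp
      rw [Walk.cons_isPath_iff] at hp
      rw [Walk.map_cons, Walk.cons_isPath_iff]
      refine ⟨ih hp.1, fun hmem => ?_⟩
      have hs := hH.eq_snd_of_adj_start (ih hp.1) (f.map_adj h).symm hmem
      cases p with
      | nil =>
        simp only [Walk.map_nil, Walk.support_nil, List.mem_singleton] at hmem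
        exact (f.map_adj h).ne hmem
      | cons h' p =>
        rw [Walk.map_cons, Walk.snd_cons] at hs
        have := hf _ _ _ h.symm h' hs
        subst this
        simp at hp
  intro x y hxy
  obtain ⟨p, hp⟩ := (hG x y).exists_isPath
  have h1 := key p hp
  have h2 : (p.map f).length = 0 := by
    have h3 : ((p.map f).copy rfl hxy.symm).IsPath := by rwa [Walk.isPath_copy]
    have h4 := Walk.length_eq_zero_iff.2 (Walk.isPath_iff_nil.1 h3)
    rwa [Walk.length_copy] at h4
  rw [Walk.length_map] at h2
  exact Walk.eq_of_length_eq_zero h2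

/-- An injective endomorphism of a tree that fixes two distinct vertices fixes a neighbor of the
first. -/
theorem IsTree.exists_adj_fixed (hG : G.IsTree) (φ : G →g G) (hφ : Function.Injective φ) {a b : V}
    (ha : φ a = a) (hb : φ b = b) (hab : a ≠ b) : ∃ r, G.Adj a r ∧ φ r = r := by
  classical
  obtain ⟨p, hp⟩ := (hG.connected a b).exists_isPath
  have h1 : ((p.map φ).copy ha hb).IsPath := by
    simpa using hp.map hφ
  have h2 : (p.map φ).copy ha hb = p :=
    congrArg Subtype.val ((hG.isAcyclic.subsingleton_path a b).elim ⟨_, h1⟩ ⟨p, hp⟩)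
  cases p with
  | nil => exact absurd rfl hab
  | @cons _ r _ h p =>
    refine ⟨r, h, ?_⟩
    have h3 := congrArg (fun q => q.getVert 1) h2
    simpa using h3

/-- The graph on a quotient of the vertex set, without loops. -/
def quotientGraph (G : SimpleGraph V) (r : Setoid V) : SimpleGraph (Quotient r) where
  Adj p q := p ≠ q ∧ ∃ x y, G.Adj x y ∧ Quotient.mk r x = p ∧ Quotient.mk r y = q
  symm := ⟨fun _ _ ⟨h, x, y, hxy, hx, hy⟩ => ⟨h.symm, y, x, hxy.symm, hy, hx⟩⟩
  loopless := ⟨fun _ h => h.1 rfl⟩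

theorem Connected.quotientGraph (hG : G.Connected) (r : Setoid V) :
    (G.quotientGraph r).Connected := by
  have := hG.nonempty.map (Quotient.mk r)
  refine ⟨fun p q => ?_⟩
  induction p using Quotient.inductionOn with | _ x
  induction q using Quotient.inductionOn with | _ y
  obtain ⟨w⟩ := hG x y
  induction w with
  | nil => exact Reachable.refl _
  | @cons a b c h w ih =>
    refine Reachable.trans ?_ ih
    by_cases hab : Quotient.mk r a = Quotient.mk r b
    · rw [hab]
    · exact Adj.reachable ⟨hab, _, _, h, rfl, rfl⟩

theorem bool_cut_eq_of_eqvGen {R : V → V → Prop} {χ : V → Bool} (h : ∀ a b, R a b → χ a = χ b)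
    {x y : V} (hxy : Relation.EqvGen R x y) : χ x = χ y := by
  induction hxy with
  | rel _ _ h' => exact h _ _ h'
  | refl => rfl
  | symm _ _ _ ih => exact ih.symm
  | trans _ _ _ _ _ ih1 ih2 => exact ih1.trans ih2

/-- The quotient of a tree by a relation generated by pairs with a common neighbor is a tree. -/
theorem IsTree.quotientGraph (hG : G.IsTree) {R : V → V → Prop}
    (hR : ∀ a b, R a b → ∃ w, G.Adj w a ∧ G.Adj w b) :
    (G.quotientGraph (Relation.EqvGen.setoid R)).IsTree := by
  refine ⟨hG.connected.quotientGraph _, IsAcyclic.of_cuts ?_⟩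
  rintro p q ⟨hpq, x, y, hxy, rfl, rfl⟩
  let mk := Quotient.mk (Relation.EqvGen.setoid R)
  -- The cut consists of all edges above the given edge. For a generating pair with common neighbor
  -- `w`, the edges to `w` have the same image, so both cross the cut or neither does; hence the
  -- coloring descends to the quotient.
  obtain ⟨χ, hχ⟩ := hG.exists_cut {e | Sym2.map mk e = s(mk x, mk y)}
  have hχR : ∀ a b, R a b → χ a = χ b := by
    intro a b hab
    obtain ⟨w, ha, hb⟩ := hR a b hab
    have h1 := hχ w a ha
    have h2 := hχ w b hb
    have h3 : mk a = mk b := Quotient.sound (Relation.EqvGen.rel _ _ hab)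
    simp only [Set.mem_ofPred_eq, Sym2.map_mk, h3] at h1 h2
    have := h1.trans h2.symm
    revert this
    cases χ w <;> cases χ a <;> cases χ b <;> simp
  refine ⟨Quotient.lift χ fun a b h => bool_cut_eq_of_eqvGen hχR h, ?_, ?_⟩
  · exact (hχ x y hxy).2 rfl
  · rintro _ _ ⟨-, x', y', hxy', rfl, rfl⟩ h
    exact (hχ x' y' hxy').1 h

/-- Edges identified in the quotient of a tree lie in the same edge sets invariant under the
generating identifications. -/
theorem IsTree.mem_of_eqvGen (hG : G.IsTree) {R : V → V → Prop} {E : Set (Sym2 V)}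
    (hR : ∀ a b, R a b → ∃ w, G.Adj w a ∧ G.Adj w b ∧ (s(w, a) ∈ E ↔ s(w, b) ∈ E))
    {x y x' y' : V} (hxy : G.Adj x y) (hxy' : G.Adj x' y') (hx : Relation.EqvGen R x x')
    (hy : Relation.EqvGen R y y') (h : s(x, y) ∈ E) : s(x', y') ∈ E := by
  -- The coloring with boundary `E` is constant on classes, so whether an edge lies in `E` depends
  -- only on the classes of its endpoints.
  obtain ⟨χ, hχ⟩ := hG.exists_cut E
  have hχR : ∀ a b, R a b → χ a = χ b := by
    intro a b hab
    obtain ⟨w, ha, hb, hE⟩ := hR a b hab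
    have := ((hχ w a ha).trans hE).trans (hχ w b hb).symm
    revert this
    cases χ w <;> cases χ a <;> cases χ b <;> simp
  rw [← hχ _ _ hxy', ← bool_cut_eq_of_eqvGen hχR hx, ← bool_cut_eq_of_eqvGen hχR hy]
  exact (hχ _ _ hxy).2 h

/-- The graph in which each edge `{a i, x i}` is replaced by `{a' i, x i}`. -/
def slide {ι : Type*} (G : SimpleGraph V) (a x a' : ι → V) : SimpleGraph V :=
  G.deleteEdges (Set.range fun i => s(a i, x i)) ⊔ fromEdgeSet (Set.range fun i => s(a' i, x i))

theorem bool_cut_eq_of_reachable {χ : V → Bool} (h : ∀ x y, G.Adj x y → χ x = χ y) {x y : V}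
    (hxy : G.Reachable x y) : χ x = χ y := by
  obtain ⟨w⟩ := hxy
  induction w with
  | nil => rfl
  | cons h' _ ih => exact (h _ _ h').trans ih

/-- Sliding edges of a tree along edges that do not move yields a tree. -/
theorem IsTree.slide {ι : Type*} (hG : G.IsTree) {a x a' : ι → V}
    (hax : ∀ i, G.Adj (a i) (x i)) (hinj : Function.Injective fun i => s(a i, x i))
    (hreach : ∀ i, (G.deleteEdges (Set.range fun i => s(a i, x i))).Reachable (a i) (a' i)) :
    (G.slide a x a').IsTree := by
  set N := G.deleteEdges (Set.range fun i => s(a i, x i)) with hN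
  have hNadj : ∀ {y z}, N.Adj y z ↔ G.Adj y z ∧ s(y, z) ∉ Set.range fun i => s(a i, x i) :=
    deleteEdges_adj ..
  -- A cut through a single moving edge is not crossed by the fixed edges `N`, so it does not
  -- separate `a j` from `a' j`.
  have hcut : ∀ i (χ : V → Bool),
      (∀ y z, G.Adj y z → (χ y ≠ χ z ↔ s(y, z) ∈ ({s(a i, x i)} : Set (Sym2 V)))) →
      ∀ j, χ (a j) = χ (a' j) := by
    intro i χ hχ j
    refine bool_cut_eq_of_reachable (G := N) (fun y z h => ?_) (hreach j)
    by_contra hne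
    exact (hNadj.1 h).2 ⟨i, ((hχ y z (hNadj.1 h).1).1 hne).symm⟩
  have hne : ∀ i, a' i ≠ x i := by
    intro i h
    obtain ⟨χ, hχ⟩ := hG.exists_cut {s(a i, x i)}
    have h1 := (hχ _ _ (hax i)).2 rfl
    rw [hcut i χ hχ i, h] at h1
    exact h1 rfl
  have hNle : N ≤ G.slide a x a' := le_sup_left
  have hnew : ∀ i, (G.slide a x a').Adj (a' i) (x i) := fun i =>
    Or.inr ⟨⟨i, rfl⟩, hne i⟩
  have hadj : ∀ y z, (G.slide a x a').Adj y z → N.Adj y z ∨ ∃ i, s(a' i, x i) = s(y, z) := by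
    rintro y z (h | h)
    · exact Or.inl h
    · exact Or.inr h.1
  refine ⟨?_, IsAcyclic.of_cuts ?_⟩
  · have := hG.connected.nonempty
    refine ⟨fun y z => ?_⟩
    obtain ⟨w⟩ := hG.connected y z
    have hstep : ∀ i, (G.slide a x a').Reachable (a i) (x i) := fun i =>
      ((hreach i).mono hNle).trans (hnew i).reachable
    induction w with
    | nil => exact Reachable.refl _
    | @cons b c d h w ih =>
      refine Reachable.trans ?_ ih
      by_cases hmem : s(b, c) ∈ Set.range fun i => s(a i, x i)
      · obtain ⟨i, hi⟩ := hmem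
        rcases Sym2.eq_iff.1 hi with ⟨rfl, rfl⟩ | ⟨rfl, rfl⟩
        · exact hstep i
        · exact (hstep i).symm
      · exact (hNle (hNadj.2 ⟨h, hmem⟩)).reachable
  · intro p q hpq
    rcases hadj p q hpq with hpq | ⟨i, hi⟩
    · obtain ⟨χ, hχ⟩ := hG.exists_cut {s(p, q)}
      -- The cut `χ` of the old tree may separate `a' i` from `x i`. Adding to its boundary the
      -- moving edges with `χ (a i) ≠ χ (a' i)` corrects this: on `N` the colorings `χ` and `ψ` have
      -- the same boundary, so their sum agrees at `a i` and `a' i`, which forces `ψ (a' i) = ψ (x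
      -- i)`.
      obtain ⟨ψ, hψ⟩ := hG.exists_cut
        ({s(p, q)} ∪ {e | ∃ i, e = s(a i, x i) ∧ χ (a i) ≠ χ (a' i)})
      have hψN : ∀ y z, N.Adj y z → (ψ y ≠ ψ z ↔ s(y, z) = s(p, q)) := by
        intro y z h
        rw [hψ y z (hNadj.1 h).1]
        refine ⟨?_, Or.inl⟩
        rintro (h' | ⟨j, hj, -⟩)
        · exact h'
        · exact absurd ⟨j, hj.symm⟩ (hNadj.1 h).2
      have hsame : ∀ j, (χ (a j) ^^ ψ (a j)) = (χ (a' j) ^^ ψ (a' j)) := by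
        intro j
        refine bool_cut_eq_of_reachable (G := N) (χ := fun v => χ v ^^ ψ v) (fun y z h => ?_)
          (hreach j)
        have h1 := (hψN y z h).trans (hχ y z (hNadj.1 h).1).symm
        revert h1
        cases χ y <;> cases χ z <;> cases ψ y <;> cases ψ z <;> simp
      have hψM : ∀ j, ψ (a' j) = ψ (x j) := by
        intro j
        have h1 : ψ (a j) ≠ ψ (x j) ↔ χ (a j) ≠ χ (a' j) := by
          rw [hψ _ _ (hax j)]
          constructor
          · rintro (h' | ⟨k, hk, hk'⟩)
            · exact absurd ⟨j, h'⟩ (hNadj.1 hpq).2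
            · rwa [hinj hk]
          · exact fun h' => Or.inr ⟨j, rfl, h'⟩
        have h2 := hsame j
        revert h1 h2
        cases χ (a j) <;> cases χ (a' j) <;> cases ψ (a j) <;> cases ψ (a' j) <;>
          cases ψ (x j) <;> simp
      refine ⟨ψ, (hψN p q hpq).2 rfl, fun y z h hyz => ?_⟩
      rcases hadj y z h with h | ⟨j, hj⟩
      · exact (hψN y z h).1 hyz
      · exfalso
        rcases Sym2.eq_iff.1 hj with ⟨rfl, rfl⟩ | ⟨rfl, rfl⟩
        · exact hyz (hψM j)
        · exact hyz (hψM j).symm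
    · obtain ⟨χ, hχ⟩ := hG.exists_cut {s(a i, x i)}
      have hnewχ : ∀ j, χ (a' j) ≠ χ (x j) ↔ j = i := by
        intro j
        rw [← hcut i χ hχ j, hχ _ _ (hax j)]
        exact ⟨fun h => hinj h, fun h => by rw [h]; rfl⟩
      rw [← hi]
      refine ⟨χ, ?_, fun y z h hyz => ?_⟩
      · rcases Sym2.eq_iff.1 hi with ⟨rfl, rfl⟩ | ⟨rfl, rfl⟩
        · exact (hnewχ i).2 rfl
        · exact ((hnewχ i).2 rfl).symm
      · rcases hadj y z h with h | ⟨j, hj⟩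
        · exact absurd ⟨i, ((hχ y z (hNadj.1 h).1).1 hyz).symm⟩ (hNadj.1 h).2
        · have hj' : χ (a' j) ≠ χ (x j) := by
            rcases Sym2.eq_iff.1 hj with ⟨rfl, rfl⟩ | ⟨rfl, rfl⟩
            · exact hyz
            · exact hyz.symm
          rw [← hj, (hnewχ j).1 hj']

end SimpleGraph

/-! ### Resolutions, their folds and slides -/

/-- A resolution of a splitting `T`: a tree with trivial edge stabilizers and finitely many orbits
of edges, with an equivariant map to the tree of `T` that sends edges to edges. -/
structure Resolution {G : Type} [Group G] (T : Splitting G) : Type 1 where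
  V : Type
  graph : SimpleGraph V
  action : MulAction G V
  isTree : graph.IsTree
  adj_smul : ∀ (g : G) (x y : V), graph.Adj x y → graph.Adj (g • x) (g • y)
  f : V → T.V
  map_smul : ∀ (g : G) (x : V), f (g • x) = g • f x
  map_adj : ∀ x y : V, graph.Adj x y → T.graph.Adj (f x) (f y)
  free : ∀ (g : G) (x y : V), graph.Adj x y → g • x = x → g • y = y → g = 1
  /-- Representatives of the orbits of edges. -/
  reps : Finset (V × V)
  exists_rep : ∀ x y : V, graph.Adj x y → ∃ d ∈ reps, ∃ g : G, s(g • d.1, g • d.2) = s(x, y)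

attribute [instance] Resolution.action

/-- The action on the quotient by an equivalence relation generated by an invariant relation. -/
@[reducible] def quotientAction {G V : Type*} [Group G] [MulAction G V] (R : V → V → Prop)
    (hR : ∀ (g : G) (a b : V), R a b → R (g • a) (g • b)) :
    MulAction G (Quotient (Relation.EqvGen.setoid R)) where
  smul g := Quotient.map (fun x => g • x) (fun a b h => by
    induction h with
    | rel _ _ h => exact Relation.EqvGen.rel _ _ (hR g _ _ h)
    | refl => exact Relation.EqvGen.refl _
    | symm _ _ _ ih => exact Relation.EqvGen.symm _ _ ih
    | trans _ _ _ _ _ ih1 ih2 => exact Relation.EqvGen.trans _ _ _ ih1 ih2)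
  one_smul p := Quotient.inductionOn p fun x => congrArg (Quotient.mk _) (one_smul G x)
  mul_smul g h p := Quotient.inductionOn p fun x => congrArg (Quotient.mk _) (mul_smul g h x)

namespace Resolution

variable {G : Type} [Group G] {T : Splitting G} (S : Resolution T)

/-- The path between two fixed vertices is fixed pointwise, and it contains an edge, whose
stabilizer is trivial. -/
theorem eq_one_of_fixed {g : G} {a b : S.V} (ha : g • a = a) (hb : g • b = b) (hab : a ≠ b) :
    g = 1 := by
  obtain ⟨r, har, hr⟩ := S.isTree.exists_adj_fixed ⟨fun x => g • x, fun {x y} => S.adj_smul g x y⟩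
    (MulAction.injective g) ha hb hab
  exact S.free g a r har ha hr

/-- Translates of edges with the same image have the same orientation. -/
theorem smul_eq_of_sym2 {g : G} {x y x' y' : S.V} (hxy : S.graph.Adj x y)
    (h : s(g • x, g • y) = s(x', y')) (hx : S.f x = S.f x') (hy : S.f y = S.f y') :
    g • x = x' ∧ g • y = y' := by
  rcases Sym2.eq_iff.1 h with h | ⟨h1, h2⟩
  · exact h
  · exact absurd ⟨by rw [← S.map_smul, h1, hy], by rw [← S.map_smul, h2, hx]⟩
      (T.no_inversion g _ _ (S.map_adj x y hxy))

theorem sym2_smul_eq {g h : G} {x y x' y' : S.V} (e : s(h • x, h • y) = s(x', y')) :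
    s((g * h) • x, (g * h) • y) = s(g • x', g • y') := by
  have := congrArg (Sym2.map fun z => g • z) e
  simpa [mul_smul] using this

theorem sym2_mul_smul {g h : G} {x y x' y' : S.V} (e : s(g • x, g • y) = s(h • x', h • y')) :
    s((h⁻¹ * g) • x, (h⁻¹ * g) • y) = s(x', y') := by
  have := S.sym2_smul_eq (g := h⁻¹) e
  simpa using this

/-- Folding two edges in distinct orbits. -/
theorem exists_fold {v u₁ u₂ : S.V} (h₁ : S.graph.Adj v u₁) (h₂ : S.graph.Adj v u₂)
    (hf : S.f u₁ = S.f u₂) (hno : ∀ g : G, g • v = v → g • u₁ ≠ u₂) :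
    ∃ S' : Resolution T, S'.reps.card < S.reps.card := by
  classical
  let R : S.V → S.V → Prop := fun a b => ∃ γ : G, a = γ • u₁ ∧ b = γ • u₂
  have hRsmul : ∀ (g : G) (a b : S.V), R a b → R (g • a) (g • b) := by
    rintro g _ _ ⟨γ, rfl, rfl⟩
    exact ⟨g * γ, (mul_smul ..).symm, (mul_smul ..).symm⟩
  have hRf : ∀ a b, Relation.EqvGen R a b → S.f a = S.f b := by
    intro a b h
    induction h with
    | rel _ _ h =>
      obtain ⟨γ, rfl, rfl⟩ := h
      rw [S.map_smul, S.map_smul, hf]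
    | refl => rfl
    | symm _ _ _ ih => exact ih.symm
    | trans _ _ _ _ _ ih1 ih2 => exact ih1.trans ih2
  have hno' : ∀ g : G, g • v = v → g • u₂ ≠ u₁ := by
    intro g hv hu
    apply hno g⁻¹
    · rw [inv_smul_eq_iff, hv]
    · rw [inv_smul_eq_iff, hu]
  -- Each translate of either edge determines the translating element, because the two edges lie in
  -- distinct orbits and have trivial stabilizers.
  have key : ∀ (δ γ : G) (a b : S.V), (a = u₁ ∨ a = u₂) → (b = u₁ ∨ b = u₂) →
      s(δ • v, δ • a) = s(γ • v, γ • b) → δ = γ := by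
    intro δ γ a b ha hb h
    have hva : S.graph.Adj v a := by rcases ha with rfl | rfl <;> assumption
    have hab : S.f a = S.f b := by rcases ha with rfl | rfl <;> rcases hb with rfl | rfl <;> simp [hf]
    obtain ⟨e1, e2⟩ := S.smul_eq_of_sym2 hva (S.sym2_mul_smul h) rfl hab
    have hab' : a = b := by
      rcases ha with rfl | rfl <;> rcases hb with rfl | rfl
      · rfl
      · exact absurd e2 (hno _ e1)
      · exact absurd e2 (hno' _ e1)
      · rfl
    subst hab'
    have := S.free _ v a hva e1 e2
    rw [inv_mul_eq_one] at this
    exact this.symm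
  let mk : S.V → Quotient (Relation.EqvGen.setoid R) := Quotient.mk _
  let act := quotientAction R hRsmul
  have hmk : ∀ (g : G) (x : S.V), g • mk x = mk (g • x) := fun _ _ => rfl
  have hmkR : ∀ γ : G, mk (γ • u₁) = mk (γ • u₂) := fun γ =>
    Quotient.sound (Relation.EqvGen.rel _ _ ⟨γ, rfl, rfl⟩)
  have hmkf : ∀ x y, mk x = mk y → S.f x = S.f y := fun x y h => hRf x y (Quotient.exact h)
  obtain ⟨d₁, hd₁, g₁, e₁⟩ := S.exists_rep v u₁ h₁
  obtain ⟨d₂, hd₂, g₂, e₂⟩ := S.exists_rep v u₂ h₂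
  have hd : d₁ ≠ d₂ := by
    rintro rfl
    have e : s((g₂ * g₁⁻¹) • v, (g₂ * g₁⁻¹) • u₁) = s(v, u₂) := by
      have h1 := S.sym2_smul_eq (g := g₂ * g₁⁻¹) e₁
      rw [inv_mul_cancel_right, e₂] at h1
      exact h1.symm
    obtain ⟨i1, i2⟩ := S.smul_eq_of_sym2 h₁ e rfl hf
    exact hno _ i1 i2
  refine ⟨{
    V := Quotient (Relation.EqvGen.setoid R)
    graph := S.graph.quotientGraph _
    action := act
    isTree := S.isTree.quotientGraph ?_
    adj_smul := ?_
    f := Quotient.lift S.f hRf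
    map_smul := ?_
    map_adj := ?_
    free := ?_
    reps := (S.reps.erase d₂).image (Prod.map mk mk)
    exists_rep := ?_ }, ?_⟩
  · rintro _ _ ⟨γ, rfl, rfl⟩
    exact ⟨γ • v, S.adj_smul γ _ _ h₁, S.adj_smul γ _ _ h₂⟩
  · rintro g p q ⟨hpq, x, y, hxy, rfl, rfl⟩
    refine ⟨fun h => hpq (MulAction.injective g h), g • x, g • y, S.adj_smul g _ _ hxy, rfl, rfl⟩
  · intro g p
    induction p using Quotient.inductionOn with | _ x
    exact S.map_smul g x
  · rintro p q ⟨-, x, y, hxy, rfl, rfl⟩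
    exact S.map_adj x y hxy
  · rintro g p q ⟨-, x, y, hxy, rfl, rfl⟩ hx hy
    have hx' : Relation.EqvGen R x (g • x) := Quotient.exact hx.symm
    have hy' : Relation.EqvGen R y (g • y) := Quotient.exact hy.symm
    have hgxy := S.adj_smul g _ _ hxy
    by_cases hcase : ∃ (γ : G) (a : S.V), (a = u₁ ∨ a = u₂) ∧ s(x, y) = s(γ • v, γ • a)
    · obtain ⟨γ, a, ha, e⟩ := hcase
      -- The fold identifies the translate by `γ` of one edge only with the translate by `γ` of the
      -- other. Hence an element `g` fixing the folded edge satisfies `g * γ = γ`.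
      have hmem : s(g • x, g • y) ∈ {e | ∃ b, (b = u₁ ∨ b = u₂) ∧ e = s(γ • v, γ • b)} := by
        refine S.isTree.mem_of_eqvGen (R := R) ?_ hxy hgxy hx' hy' ⟨a, ha, e⟩
        rintro _ _ ⟨δ, rfl, rfl⟩
        refine ⟨δ • v, S.adj_smul δ _ _ h₁, S.adj_smul δ _ _ h₂, ?_, ?_⟩
        · rintro ⟨b, hb, e'⟩
          have := key δ γ _ b (Or.inl rfl) hb e'
          subst this
          exact ⟨u₂, Or.inr rfl, rfl⟩
        · rintro ⟨b, hb, e'⟩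
          have := key δ γ _ b (Or.inr rfl) hb e'
          subst this
          exact ⟨u₁, Or.inl rfl, rfl⟩
      obtain ⟨b, hb, e'⟩ := hmem
      have h1 : s((g * γ) • v, (g * γ) • a) = s(γ • v, γ • b) := by
        rw [S.sym2_smul_eq e.symm, e']
      simpa using key _ _ _ _ ha hb h1
    · have hmem : s(g • x, g • y) ∈ ({s(x, y)} : Set (Sym2 S.V)) := by
        refine S.isTree.mem_of_eqvGen (R := R) ?_ hxy hgxy hx' hy' rfl
        rintro _ _ ⟨δ, rfl, rfl⟩
        refine ⟨δ • v, S.adj_smul δ _ _ h₁, S.adj_smul δ _ _ h₂, fun h => ?_, fun h => ?_⟩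
        · exact absurd ⟨δ, u₁, Or.inl rfl, h.symm⟩ hcase
        · exact absurd ⟨δ, u₂, Or.inr rfl, h.symm⟩ hcase
      obtain ⟨i1, i2⟩ := S.smul_eq_of_sym2 hxy hmem rfl rfl
      exact S.free g x y hxy i1 i2
  · rintro p q ⟨-, x, y, hxy, rfl, rfl⟩
    obtain ⟨d, hdD, g, e⟩ := S.exists_rep x y hxy
    have hmap : ∀ {a b a' b' : S.V}, s(a, b) = s(a', b') → s(mk a, mk b) = s(mk a', mk b') :=
      fun h => congrArg (Sym2.map mk) h
    -- The representative `d₂` is redundant: its orbit is now that of `d₁`.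
    by_cases hdd : d = d₂
    · subst hdd
      refine ⟨Prod.map mk mk d₁, Finset.mem_image_of_mem _ (Finset.mem_erase.2 ⟨hd, hd₁⟩),
        (g * g₂⁻¹) * g₁, ?_⟩
      have i1 := hmap (S.sym2_smul_eq (g := g * g₂⁻¹) e₁)
      have i2 := hmap (S.sym2_smul_eq (g := g * g₂⁻¹) e₂)
      rw [inv_mul_cancel_right] at i2
      refine i1.trans (Eq.trans ?_ (i2.symm.trans (hmap e)))
      rw [hmkR]
    · exact ⟨Prod.map mk mk d, Finset.mem_image_of_mem _ (Finset.mem_erase.2 ⟨hdd, hdD⟩), g,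
        hmap e⟩
  · exact Finset.card_image_le.trans_lt (Finset.card_erase_lt_of_mem hd₂)

/-- The graph without the orbit of an edge. -/
abbrev deleteOrbit (a x : S.V) : SimpleGraph S.V :=
  S.graph.deleteEdges (Set.range fun γ : G => s(γ • a, γ • x))

theorem deleteOrbit_adj {a x y z : S.V} : (S.deleteOrbit a x).Adj y z ↔
    S.graph.Adj y z ∧ ∀ γ : G, s(γ • a, γ • x) ≠ s(y, z) := by
  rw [deleteOrbit, SimpleGraph.deleteEdges_adj, Set.mem_range, not_exists]

theorem deleteOrbit_adj_smul {a x y z : S.V} (g : G) (h : (S.deleteOrbit a x).Adj y z) :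
    (S.deleteOrbit a x).Adj (g • y) (g • z) := by
  rw [deleteOrbit_adj] at h ⊢
  exact ⟨S.adj_smul g _ _ h.1, fun γ e => h.2 _ (S.sym2_mul_smul e)⟩

theorem deleteOrbit_reachable_smul {a x y z : S.V} (g : G)
    (h : (S.deleteOrbit a x).Reachable y z) :
    (S.deleteOrbit a x).Reachable (g • y) (g • z) :=
  h.map ⟨fun v => g • v, fun h => S.deleteOrbit_adj_smul g h⟩

/-- In a tree the single edge `{g • a, g • x}` already separates its endpoints. -/
theorem not_deleteOrbit_reachable {a x : S.V} (hax : S.graph.Adj a x) (g : G) :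
    ¬ (S.deleteOrbit a x).Reachable (g • a) (g • x) := by
  intro h
  obtain ⟨χ, hχ⟩ := S.isTree.exists_cut {s(g • a, g • x)}
  refine (hχ _ _ (S.adj_smul g _ _ hax)).2 rfl
    (SimpleGraph.bool_cut_eq_of_reachable (fun y z hyz => ?_) h)
  rw [deleteOrbit_adj] at hyz
  by_contra hne
  exact hyz.2 g ((hχ _ _ hyz.1).1 hne).symm

open Classical in
/-- Sliding the orbit of an edge `{a, x}` to the orbit of `{a', x}`. -/
noncomputable def slide {a x a' : S.V} (hax : S.graph.Adj a x) (hf : S.f a' = S.f a)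
    (hreach : (S.deleteOrbit a x).Reachable a a') : Resolution T where
  V := S.V
  graph := S.graph.slide (fun γ : G => γ • a) (fun γ => γ • x) (fun γ => γ • a')
  action := S.action
  isTree := by
    refine S.isTree.slide (fun γ => S.adj_smul γ _ _ hax) (fun γ δ h => ?_)
      (fun γ => S.deleteOrbit_reachable_smul γ hreach)
    obtain ⟨i1, i2⟩ := S.smul_eq_of_sym2 hax (S.sym2_mul_smul h) rfl rfl
    have := S.free _ _ _ hax i1 i2
    rw [inv_mul_eq_one] at this
    exact this.symm
  adj_smul g y z h := by
    rcases h with h | ⟨⟨γ, hγ⟩, hne⟩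
    · exact Or.inl (S.deleteOrbit_adj_smul g h)
    · exact Or.inr ⟨⟨g * γ, S.sym2_smul_eq hγ⟩, fun h => hne (MulAction.injective g h)⟩
  f := S.f
  map_smul := S.map_smul
  map_adj y z h := by
    rcases h with h | ⟨⟨γ, hγ⟩, hne⟩
    · exact S.map_adj _ _ (S.deleteOrbit_adj.1 h).1
    · have h1 : T.graph.Adj (S.f (γ • a')) (S.f (γ • x)) := by
        have := S.map_adj _ _ (S.adj_smul γ _ _ hax)
        rwa [S.map_smul, ← hf, ← S.map_smul] at this
      rcases Sym2.eq_iff.1 hγ with ⟨rfl, rfl⟩ | ⟨rfl, rfl⟩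
      · exact h1
      · exact h1.symm
  free g y z h hy hz := S.eq_one_of_fixed hy hz h.ne
  reps := insert (a', x) (S.reps.erase (S.exists_rep a x hax).choose)
  exists_rep y z h := by
    obtain ⟨-, g₀, e₀⟩ := (S.exists_rep a x hax).choose_spec
    rcases h with h | ⟨⟨γ, hγ⟩, hne⟩
    · rw [← deleteOrbit, deleteOrbit_adj] at h
      obtain ⟨d, hd, g, e⟩ := S.exists_rep y z h.1
      refine ⟨d, Finset.mem_insert_of_mem (Finset.mem_erase.2 ⟨?_, hd⟩), g, e⟩
      rintro rfl
      refine h.2 (g * g₀⁻¹) ?_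
      have i1 := S.sym2_smul_eq (g := g * g₀⁻¹) e₀
      rw [inv_mul_cancel_right, e] at i1
      exact i1.symm
    · exact ⟨(a', x), Finset.mem_insert_self _ _, γ, hγ⟩

theorem slide_card {a x a' : S.V} (hax : S.graph.Adj a x) (hf : S.f a' = S.f a)
    (hreach : (S.deleteOrbit a x).Reachable a a') :
    (S.slide hax hf hreach).reps.card ≤ S.reps.card := by
  classical
  have hmem := (S.exists_rep a x hax).choose_spec.1
  refine (Finset.card_insert_le _ _).trans ?_
  exact (Finset.card_erase_add_one hmem).le

/-- Two edges in distinct orbits with the same image, whose initial vertices are joined by a path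
that avoids the orbit of the first edge, can be folded after a slide. -/
theorem exists_fold_of_reachable {a x a' y : S.V} (hax : S.graph.Adj a x)
    (hay : S.graph.Adj a' y) (hfa : S.f a' = S.f a) (hfx : S.f x = S.f y)
    (hreach : (S.deleteOrbit a x).Reachable a a') (hno : ∀ g : G, g • a = a' → g • x ≠ y) :
    ∃ S' : Resolution T, S'.reps.card < S.reps.card := by
  have hN : (S.deleteOrbit a x).Adj a' y := by
    refine S.deleteOrbit_adj.2 ⟨hay, fun γ e => ?_⟩
    obtain ⟨i1, i2⟩ := S.smul_eq_of_sym2 hax e hfa.symm hfx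
    exact hno _ i1 i2
  have hne : a' ≠ x := by
    rintro rfl
    exact (S.map_adj _ _ hax).ne hfa.symm
  -- After the slide both edges start at `a'`. An element `g` fixing `a'` and taking `x` to `y`
  -- would yield a path from `g • a` through `a'` to `y = g • x` in the old tree that avoids the
  -- orbit of `{a, x}`, which is impossible.
  obtain ⟨S', hS'⟩ := (S.slide hax hfa hreach).exists_fold (v := a') (u₁ := x) (u₂ := y)
    (Or.inr ⟨⟨1, by simp⟩, hne⟩) (Or.inl hN) hfx (fun g (h1 : g • a' = a') (h2 : g • x = y) => by
      apply S.not_deleteOrbit_reachable hax g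
      rw [h2]
      have := S.deleteOrbit_reachable_smul g hreach
      rw [h1] at this
      exact this.trans hN.reachable)
  exact ⟨S', hS'.trans_le (S.slide_card hax hfa hreach)⟩

end Resolution

namespace Splitting

variable {G : Type} [Group G] (T : Splitting G)

theorem mem_edgeStabilizer {x y : T.V} {g : G} :
    g ∈ T.edgeStabilizer x y ↔ g • x = x ∧ g • y = y := Iff.rfl

theorem exists_adj_of_numEdges (h : T.numEdges = 1) : ∃ x y, T.graph.Adj x y := by
  obtain ⟨⟨e⟩⟩ := (Nat.card_eq_one_iff_unique.1 h).2
  obtain ⟨⟨x, y⟩, hxy⟩ := e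
  exact ⟨x, y, hxy⟩

theorem exists_smul_of_numEdges (h : T.numEdges = 1) {x y x' y' : T.V} (hxy : T.graph.Adj x y)
    (hxy' : T.graph.Adj x' y') : ∃ g : G, s(g • x, g • y) = s(x', y') := by
  have h1 := (Nat.card_eq_one_iff_unique.1 h).1
  exact Quotient.exact (h1.elim (Quotient.mk T.edgeSetoid ⟨s(x, y), hxy⟩)
    (Quotient.mk T.edgeSetoid ⟨s(x', y'), hxy'⟩))

theorem numEdges_eq_one {x y : T.V} (hxy : T.graph.Adj x y)
    (h : ∀ x' y', T.graph.Adj x' y' → ∃ g : G, s(g • x, g • y) = s(x', y')) :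
    T.numEdges = 1 := by
  refine Nat.card_eq_one_iff_unique.2 ⟨⟨fun e e' => ?_⟩, ⟨Quotient.mk _ ⟨s(x, y), hxy⟩⟩⟩
  have key : ∀ e, Quotient.mk T.edgeSetoid ⟨s(x, y), hxy⟩ = e := by
    intro e
    induction e using Quotient.inductionOn with | _ e
    obtain ⟨⟨x', y'⟩, hxy'⟩ := e
    exact Quotient.sound (h x' y' hxy')
  rw [← key e, ← key e']

end Splitting

/-! ### Minimal resolutions with a fold edge -/

namespace Resolution

variable {G : Type} [Group G] {T : Splitting G} (S : Resolution T)

/-- The image of an invariant subtree is an invariant subtree of the minimal tree `T`. This gives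
surjectivity of `f` and, later, minimality of the resolution itself. -/
theorem image_eq_univ (A : Set S.V) (hA : A.Nonempty) (hsmul : ∀ (g : G), ∀ x ∈ A, g • x ∈ A)
    (hconn : (S.graph.induce A).Connected) : S.f '' A = Set.univ := by
  refine T.minimal _ (hA.image _) ?_ ?_
  · rintro g _ ⟨x, hx, rfl⟩
    exact ⟨g • x, hsmul g x hx, S.map_smul g x⟩
  · refine hconn.map (⟨fun x => ⟨S.f x.1, x.1, x.2, rfl⟩, fun {x y} h => S.map_adj _ _ h⟩ :
      S.graph.induce A →g T.graph.induce (S.f '' A)) ?_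
    rintro ⟨_, x, hx, rfl⟩
    exact ⟨⟨x, hx⟩, rfl⟩

theorem surjective : Function.Surjective S.f := by
  rw [← Set.range_eq_univ, ← Set.image_univ]
  obtain ⟨o⟩ := S.isTree.connected.nonempty
  refine S.image_eq_univ _ ⟨o, trivial⟩ (fun _ _ _ => trivial) ?_
  rw [SimpleGraph.connected_iff]
  refine ⟨fun x y => ?_, ⟨⟨o, trivial⟩⟩⟩
  exact (S.isTree.connected x.1 y.1).map
    ⟨fun z => (⟨z, trivial⟩ : (Set.univ : Set S.V)), fun h => h⟩

/-- An edge of a resolution at which `T` is folded: the stabilizer of its image fixes one of its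
endpoints. -/
structure FoldEdge where
  p : S.V
  u : S.V
  adj : S.graph.Adj p u
  smul_p : ∀ g ∈ T.edgeStabilizer (S.f p) (S.f u), g • p = p

namespace FoldEdge

variable {S} (F : S.FoldEdge)

/-- The identifications generated by the fold. -/
def R (a b : S.V) : Prop :=
  ∃ (γ : G), ∃ h ∈ T.edgeStabilizer (S.f F.p) (S.f F.u), a = γ • F.u ∧ b = (γ * h) • F.u

theorem R_smul (g : G) (a b : S.V) (h : F.R a b) : F.R (g • a) (g • b) := by
  obtain ⟨γ, k, hk, rfl, rfl⟩ := h
  exact ⟨g * γ, k, hk, (mul_smul ..).symm, by rw [← mul_smul, mul_assoc]⟩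

theorem f_eq_of_eqvGen {a b : S.V} (h : Relation.EqvGen F.R a b) : S.f a = S.f b := by
  induction h with
  | rel _ _ h =>
    obtain ⟨γ, k, hk, rfl, rfl⟩ := h
    rw [S.map_smul, S.map_smul, mul_smul, (T.mem_edgeStabilizer.1 hk).2]
  | refl => rfl
  | symm _ _ _ ih => exact ih.symm
  | trans _ _ _ _ _ ih1 ih2 => exact ih1.trans ih2

/-- The translates of the edge. -/
def IsTranslate (a x : S.V) : Prop := ∃ γ : G, s(γ • F.p, γ • F.u) = s(a, x)

variable {F}

theorem IsTranslate.smul {a x : S.V} {g : G} (h : F.IsTranslate (g • a) (g • x)) :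
    F.IsTranslate a x := by
  obtain ⟨γ, hγ⟩ := h
  exact ⟨g⁻¹ * γ, S.sym2_mul_smul hγ⟩

theorem IsTranslate.symm {a x : S.V} (h : F.IsTranslate a x) : F.IsTranslate x a := by
  obtain ⟨γ, hγ⟩ := h
  exact ⟨γ, hγ.trans Sym2.eq_swap⟩

variable (F)

theorem isTranslate (γ : G) : F.IsTranslate (γ • F.p) (γ • F.u) := ⟨γ, rfl⟩

theorem eq_of_sym2_eq {γ δ : G} (h : s(γ • F.p, γ • F.u) = s(δ • F.p, δ • F.u)) : γ = δ := by
  obtain ⟨i1, i2⟩ := S.smul_eq_of_sym2 F.adj (S.sym2_mul_smul h) rfl rfl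
  have := S.free _ _ _ F.adj i1 i2
  rw [inv_mul_eq_one] at this
  exact this.symm

theorem mem_of_sym2_eq {γ δ : G}
    (h : s(γ • S.f F.p, γ • S.f F.u) = s(δ • S.f F.p, δ • S.f F.u)) :
    γ⁻¹ * δ ∈ T.edgeStabilizer (S.f F.p) (S.f F.u) := by
  have h1 := congrArg (Sym2.map fun z => γ⁻¹ • z) h
  simp only [Sym2.map_mk, smul_smul, inv_mul_cancel, one_smul] at h1
  rcases Sym2.eq_iff.1 h1 with ⟨i1, i2⟩ | ⟨i1, i2⟩
  · exact T.mem_edgeStabilizer.2 ⟨i1.symm, i2.symm⟩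
  · exact absurd ⟨i2.symm, i1.symm⟩ (T.no_inversion (γ⁻¹ * δ) _ _ (S.map_adj _ _ F.adj))

theorem exists_common_adj {a b : S.V} (h : F.R a b) :
    ∃ w, S.graph.Adj w a ∧ S.graph.Adj w b := by
  obtain ⟨γ, k, hk, rfl, rfl⟩ := h
  refine ⟨γ • F.p, S.adj_smul _ _ _ F.adj, ?_⟩
  have := S.adj_smul (γ * k) _ _ F.adj
  rwa [mul_smul γ k F.p, F.smul_p k hk] at this

/-- Generating pairs are joined by two translates of the folded edge, which survive when a different
orbit is deleted. This supplies the path along which `exists_fold_of_reachable` slides. -/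
theorem deleteOrbit_reachable {a x b c : S.V} (hax : ¬ F.IsTranslate a x)
    (h : Relation.EqvGen F.R b c) : (S.deleteOrbit a x).Reachable b c := by
  have hadj : ∀ γ : G, (S.deleteOrbit a x).Adj (γ • F.p) (γ • F.u) := by
    refine fun γ => S.deleteOrbit_adj.2 ⟨S.adj_smul γ _ _ F.adj, fun δ e => hax ?_⟩
    exact IsTranslate.smul (a := a) (x := x) (g := δ) ⟨γ, e.symm⟩
  induction h with
  | rel _ _ h =>
    obtain ⟨γ, k, hk, rfl, rfl⟩ := h
    have h1 := hadj (γ * k)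
    rw [mul_smul γ k F.p, F.smul_p k hk] at h1
    exact (hadj γ).symm.reachable.trans h1.reachable
  | refl => exact SimpleGraph.Reachable.refl _
  | symm _ _ _ ih => exact ih.symm
  | trans _ _ _ _ _ ih1 ih2 => exact ih1.trans ih2

/-- In a minimal resolution, edges with the same image that become adjacent after the fold lie in
one orbit, unless both are translates of the folded edge. -/
theorem exists_smul_eq (hmin : ∀ S' : Resolution T, S.reps.card ≤ S'.reps.card) {a x a' y : S.V}
    (hax : S.graph.Adj a x) (hay : S.graph.Adj a' y) (hnot : ¬ F.IsTranslate a x)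
    (haa : Relation.EqvGen F.R a a') (hxy : S.f x = S.f y) : ∃ g : G, g • a = a' ∧ g • x = y := by
  by_contra! hno
  obtain ⟨S', hS'⟩ := S.exists_fold_of_reachable hax hay (F.f_eq_of_eqvGen haa).symm hxy
    (F.deleteOrbit_reachable hnot haa) hno
  exact (hmin S').not_gt hS'

/-- Otherwise minimality puts both edges in one orbit, and being a translate of the folded edge is
invariant under the group. -/
theorem isTranslate_of_eqvGen (hmin : ∀ S' : Resolution T, S.reps.card ≤ S'.reps.card)
    {a x a' y : S.V} (hax : S.graph.Adj a x) (hay : S.graph.Adj a' y) (ht : F.IsTranslate a' y)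
    (haa : Relation.EqvGen F.R a a') (hxy : S.f x = S.f y) : F.IsTranslate a x := by
  by_contra hnot
  obtain ⟨g, rfl, rfl⟩ := F.exists_smul_eq hmin hax hay hnot haa hxy
  exact hnot (IsTranslate.smul (a := a) (x := x) ht)

/-- If a nontrivial element fixes an edge after the fold, then that edge is a translate `γ` of the
folded one, and the element fixes `γ • p` already before the fold. -/
theorem exists_translate_of_fixed {g : G} (hg : g ≠ 1) {q r : S.V} (hqr : S.graph.Adj q r)
    (hq : Relation.EqvGen F.R q (g • q)) (hr : Relation.EqvGen F.R r (g • r)) :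
    ∃ γ : G, s(γ • F.p, γ • F.u) = s(q, r) ∧ g • γ • F.p = γ • F.p := by
  have hgqr := S.adj_smul g _ _ hqr
  by_cases hcase : F.IsTranslate q r
  · obtain ⟨γ, hγ⟩ := hcase
    refine ⟨γ, hγ, ?_⟩
    -- The edges identified with the translate by `γ` are those by `γ * h` with `h` in the
    -- stabilizer of the image edge. All of them start at `γ • p`, since `h` fixes `p`.
    have hmem : s(g • q, g • r) ∈ {e | ∃ h ∈ T.edgeStabilizer (S.f F.p) (S.f F.u),
        e = s((γ * h) • F.p, (γ * h) • F.u)} := by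
      refine S.isTree.mem_of_eqvGen (R := F.R) ?_ hqr hgqr hq hr
        ⟨1, Subgroup.one_mem _, by rw [mul_one, hγ]⟩
      rintro _ _ ⟨η, k, hk, rfl, rfl⟩
      have hkp : η • F.p = (η * k) • F.p := by rw [mul_smul, F.smul_p k hk]
      refine ⟨η • F.p, S.adj_smul _ _ _ F.adj, ?_, ?_, ?_⟩
      · rw [hkp]
        exact S.adj_smul _ _ _ F.adj
      · rintro ⟨h, hh, e⟩
        refine ⟨h * k, mul_mem hh hk, ?_⟩
        rw [hkp, F.eq_of_sym2_eq e, mul_assoc]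
      · rintro ⟨h, hh, e⟩
        refine ⟨h * k⁻¹, mul_mem hh (inv_mem hk), ?_⟩
        rw [hkp] at e
        rw [← mul_assoc, ← F.eq_of_sym2_eq e, mul_inv_cancel_right]
    obtain ⟨h, hh, e⟩ := hmem
    have := F.eq_of_sym2_eq ((S.sym2_smul_eq hγ).trans e)
    rw [← mul_smul, this, mul_smul, F.smul_p h hh]
  · exfalso
    have hmem : s(g • q, g • r) ∈ ({s(q, r)} : Set (Sym2 S.V)) := by
      refine S.isTree.mem_of_eqvGen (R := F.R) ?_ hqr hgqr hq hr rfl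
      rintro _ _ ⟨η, k, hk, rfl, rfl⟩
      have hkp : η • F.p = (η * k) • F.p := by rw [mul_smul, F.smul_p k hk]
      refine ⟨η • F.p, S.adj_smul _ _ _ F.adj, ?_, fun h => ?_, fun h => ?_⟩
      · rw [hkp]
        exact S.adj_smul _ _ _ F.adj
      · exact absurd ⟨η, h⟩ hcase
      · rw [hkp] at h
        exact absurd ⟨η * k, h⟩ hcase
    obtain ⟨i1, i2⟩ := S.smul_eq_of_sym2 hqr hmem rfl rfl
    exact hg (S.free g q r hqr i1 i2)

theorem map_sym2 {γ : G} {a x : S.V} (h : s(γ • F.p, γ • F.u) = s(a, x)) :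
    s(γ • S.f F.p, γ • S.f F.u) = s(S.f a, S.f x) := by
  have := congrArg (Sym2.map S.f) h
  simpa [S.map_smul] using this

/-- After the fold a minimal resolution maps locally injectively. -/
theorem eqvGen_of_adj (hmin : ∀ S' : Resolution T, S.reps.card ≤ S'.reps.card)
    (hT : T.numEdges = 1) {a x a' y : S.V} (hax : S.graph.Adj a x) (hay : S.graph.Adj a' y)
    (haa : Relation.EqvGen F.R a a') (hxy : S.f x = S.f y) : Relation.EqvGen F.R x y := by
  have hfa := F.f_eq_of_eqvGen haa
  by_cases hnot : F.IsTranslate a x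
  · obtain ⟨δ, hδ⟩ := F.isTranslate_of_eqvGen hmin hay hax hnot haa.symm hxy.symm
    obtain ⟨γ, hγ⟩ := hnot
    have hmem := F.mem_of_sym2_eq
      ((F.map_sym2 hγ).trans (by rw [hfa, hxy, F.map_sym2 hδ]) : _ = s(δ • S.f F.p, δ • S.f F.u))
    obtain ⟨h, hh, rfl⟩ : ∃ h ∈ T.edgeStabilizer (S.f F.p) (S.f F.u), δ = γ * h :=
      ⟨_, hmem, by group⟩
    have hne := (S.map_adj _ _ F.adj).ne
    obtain ⟨hh1, hh2⟩ := T.mem_edgeStabilizer.1 hh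
    -- With equal orientations the ends are identified by the fold or coincide. With opposite ones,
    -- `f a = f a'` would identify the two ends of an edge of `T`.
    rcases Sym2.eq_iff.1 hγ with ⟨rfl, rfl⟩ | ⟨rfl, rfl⟩ <;>
      rcases Sym2.eq_iff.1 hδ with ⟨rfl, rfl⟩ | ⟨rfl, rfl⟩
    · exact Relation.EqvGen.rel _ _ ⟨γ, h, hh, rfl, rfl⟩
    · rw [S.map_smul, S.map_smul, mul_smul, hh2] at hfa
      exact absurd (MulAction.injective γ hfa) hne
    · rw [S.map_smul, S.map_smul, mul_smul, hh1] at hfa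
      exact absurd (MulAction.injective γ hfa).symm hne
    · rw [mul_smul, F.smul_p h hh]
      exact Relation.EqvGen.refl _
  · obtain ⟨g, rfl, rfl⟩ := F.exists_smul_eq hmin hax hay hnot haa hxy
    by_cases hg : g = 1
    · rw [hg, one_smul]
      exact Relation.EqvGen.refl _
    exfalso
    apply hnot
    obtain ⟨δ, hδ⟩ := T.exists_smul_of_numEdges hT (S.map_adj _ _ F.adj) (S.map_adj _ _ hax)
    -- The nontrivial element `g` fixes the image of `{a, x}`, which is the translate by `δ` of the
    -- image of the folded edge. By the defining property of a fold edge it then fixes `δ • p`.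
    have hgδ : g • δ • F.p = δ • F.p := by
      have h1 : s((g * δ) • S.f F.p, (g * δ) • S.f F.u) = s(δ • S.f F.p, δ • S.f F.u) := by
        have h3 := congrArg (Sym2.map fun z => g • z) hδ
        simp only [Sym2.map_mk, smul_smul] at h3
        rw [h3, hδ, ← S.map_smul, ← S.map_smul, ← hfa, ← hxy]
      have h2 := F.smul_p _ (F.mem_of_sym2_eq h1.symm)
      rwa [mul_smul, mul_smul, inv_smul_eq_iff] at h2
    by_cases hap : Relation.EqvGen F.R a (δ • F.p)
    · refine F.isTranslate_of_eqvGen hmin hax (S.adj_smul δ _ _ F.adj) (F.isTranslate δ) hap ?_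
      have h1 := F.f_eq_of_eqvGen hap
      rw [S.map_smul] at h1 ⊢
      rcases Sym2.eq_iff.1 hδ with ⟨-, h2⟩ | ⟨h2, -⟩
      · exact h2.symm
      · exact absurd (h1.trans h2) (S.map_adj _ _ hax).ne
    -- In the folded tree `g` fixes the distinct classes of `a` and `δ • p`, hence an edge at the
    -- class of `a`. That edge comes from a translate of the folded edge.
    · let act := quotientAction F.R F.R_smul
      let mk : S.V → Quotient (Relation.EqvGen.setoid F.R) := Quotient.mk _
      have hmk : ∀ (g : G) (x : S.V), g • mk x = mk (g • x) := fun _ _ => rfl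
      have hQ := S.isTree.quotientGraph (R := F.R) fun a b h => F.exists_common_adj h
      obtain ⟨r, ⟨-, q, r, hqr, hqa, rfl⟩, hgr⟩ := hQ.exists_adj_fixed (a := mk a)
        (b := mk (δ • F.p)) ⟨fun z => g • z, by
          rintro _ _ ⟨hne, x', y', hxy', rfl, rfl⟩
          exact ⟨fun h => hne (MulAction.injective g h), g • x', g • y', S.adj_smul g _ _ hxy',
            rfl, rfl⟩⟩
        (MulAction.injective g) (Quotient.sound haa.symm) (congrArg mk hgδ)
        (fun h => hap (Quotient.exact h))
      have hqa' : Relation.EqvGen F.R q a := Quotient.exact hqa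
      have hq : mk q = mk (g • q) := by
        rw [← hmk, show mk q = mk a from hqa]
        exact Quotient.sound haa
      obtain ⟨γ, hγ, hgγ⟩ := F.exists_translate_of_fixed hg hqr (Quotient.exact hq)
        (Quotient.exact hgr.symm)
      -- A nontrivial element fixes at most one vertex of `S`. So the fixed edge runs from the class
      -- of `a` to `δ • p`; comparing orientations, it has the same image as `{a, x}`, which makes
      -- `{a, x}` a translate as well.
      have hp : γ • F.p = δ • F.p := by
        by_contra hne
        exact hg (S.eq_one_of_fixed hgγ hgδ hne)
      rcases Sym2.eq_iff.1 hγ with ⟨h1, h2⟩ | ⟨h1, h2⟩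
      · exact absurd (by rw [← hp, h1]; exact hqa'.symm) hap
      · refine F.isTranslate_of_eqvGen hmin hax hqr ⟨γ, hγ⟩ hqa'.symm ?_
        rw [← h1, hp, S.map_smul]
        rcases Sym2.eq_iff.1 hδ with ⟨h3, -⟩ | ⟨h3, -⟩
        · refine absurd ?_ (S.map_adj _ _ hqr).ne
          rw [F.f_eq_of_eqvGen hqa', ← h3, ← h1, hp, S.map_smul]
        · exact h3.symm

/-- The fibers of a minimal resolution are the classes of the fold. -/
theorem eqvGen_of_f_eq (hmin : ∀ S' : Resolution T, S.reps.card ≤ S'.reps.card)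
    (hT : T.numEdges = 1) {x y : S.V} (hxy : S.f x = S.f y) : Relation.EqvGen F.R x y := by
  let φ : S.graph.quotientGraph (Relation.EqvGen.setoid F.R) →g T.graph :=
    ⟨Quotient.lift S.f fun a b h => F.f_eq_of_eqvGen h, by
      rintro _ _ ⟨-, x', y', hxy', rfl, rfl⟩
      exact S.map_adj _ _ hxy'⟩
  have hφ : Function.Injective φ := by
    refine (S.isTree.connected.quotientGraph _).injective_of_locally_injective T.isTree.isAcyclic
      φ ?_
    rintro _ _ _ ⟨-, a, x', hax, rfl, rfl⟩ ⟨-, a', y', hay, haa, rfl⟩ h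
    exact Quotient.sound (F.eqvGen_of_adj hmin hT hax hay (Quotient.exact haa.symm) h)
  exact Quotient.exact (hφ (a₁ := Quotient.mk _ x) (a₂ := Quotient.mk _ y) hxy)

/-- A minimal resolution has a single orbit of edges. -/
theorem isTranslate_of_adj (hmin : ∀ S' : Resolution T, S.reps.card ≤ S'.reps.card)
    (hT : T.numEdges = 1) {a x : S.V} (hax : S.graph.Adj a x) : F.IsTranslate a x := by
  obtain ⟨δ, hδ⟩ := T.exists_smul_of_numEdges hT (S.map_adj _ _ F.adj) (S.map_adj _ _ hax)
  rw [← S.map_smul, ← S.map_smul] at hδ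
  rcases Sym2.eq_iff.1 hδ with ⟨h1, h2⟩ | ⟨h1, h2⟩
  · exact F.isTranslate_of_eqvGen hmin hax (S.adj_smul δ _ _ F.adj) (F.isTranslate δ)
      (F.eqvGen_of_f_eq hmin hT h1.symm) h2.symm
  · exact F.isTranslate_of_eqvGen hmin hax (S.adj_smul δ _ _ F.adj).symm (F.isTranslate δ).symm
      (F.eqvGen_of_f_eq hmin hT h2.symm) h1.symm

/-- A minimal resolution as a splitting. -/
def toSplitting (hmin : ∀ S' : Resolution T, S.reps.card ≤ S'.reps.card)
    (hT : T.numEdges = 1) : Splitting G where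
  V := S.V
  graph := S.graph
  action := S.action
  isTree := S.isTree
  adj_smul := S.adj_smul
  no_inversion g x y hxy h := T.no_inversion g _ _ (S.map_adj x y hxy)
    ⟨by rw [← S.map_smul, h.1], by rw [← S.map_smul, h.2]⟩
  minimal A hA hsmul hconn := by
    have himage := S.image_eq_univ A hA hsmul hconn
    -- Since `A` maps onto `T`, it has two vertices and thus an edge. All edges lie in one orbit, so
    -- `A` contains every vertex.
    obtain ⟨x₀, hx₀, e₀⟩ : S.f F.p ∈ S.f '' A := himage ▸ trivial
    obtain ⟨x₁, hx₁, e₁⟩ : S.f F.u ∈ S.f '' A := himage ▸ trivial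
    have hne : (⟨x₀, hx₀⟩ : A) ≠ ⟨x₁, hx₁⟩ := by
      intro h
      have h' : x₀ = x₁ := congrArg Subtype.val h
      rw [h', e₁] at e₀
      exact (S.map_adj _ _ F.adj).ne e₀.symm
    have : Nontrivial A := ⟨_, _, hne⟩
    obtain ⟨z, hz⟩ := hconn.preconnected.exists_adj_of_nontrivial ⟨x₀, hx₀⟩
    obtain ⟨γ, hγ⟩ := F.isTranslate_of_adj hmin hT hz
    have hpu : F.p ∈ A ∧ F.u ∈ A := by
      rcases Sym2.eq_iff.1 hγ with ⟨h1, h2⟩ | ⟨h1, h2⟩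
      · rw [← inv_smul_smul γ F.p, ← inv_smul_smul γ F.u, h1, h2]
        exact ⟨hsmul _ _ hx₀, hsmul _ _ z.2⟩
      · rw [← inv_smul_smul γ F.p, ← inv_smul_smul γ F.u, h1, h2]
        exact ⟨hsmul _ _ z.2, hsmul _ _ hx₀⟩
    have : Nontrivial S.V := ⟨_, _, F.adj.ne⟩
    refine Set.eq_univ_of_forall fun v => ?_
    obtain ⟨w, hw⟩ := S.isTree.connected.preconnected.exists_adj_of_nontrivial v
    obtain ⟨δ, hδ⟩ := F.isTranslate_of_adj hmin hT hw
    rcases Sym2.eq_iff.1 hδ with ⟨rfl, -⟩ | ⟨-, rfl⟩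
    · exact hsmul _ _ hpu.1
    · exact hsmul _ _ hpu.2

theorem toSplitting_isOneEdgeFree (hmin : ∀ S' : Resolution T, S.reps.card ≤ S'.reps.card)
    (hT : T.numEdges = 1) : (F.toSplitting hmin hT).IsOneEdgeFree := by
  refine ⟨Splitting.numEdges_eq_one _ (x := F.p) (y := F.u) F.adj
    fun x y h => F.isTranslate_of_adj hmin hT h, fun x y h => ?_⟩
  rw [eq_bot_iff]
  intro g hg
  exact Subgroup.mem_bot.2 (S.free g x y h hg.1 hg.2)

theorem toSplitting_isEdgeFold (hmin : ∀ S' : Resolution T, S.reps.card ≤ S'.reps.card)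
    (hT : T.numEdges = 1) {w : G}
    (hw : T.edgeStabilizer (S.f F.p) (S.f F.u) = Subgroup.zpowers w) :
    (F.toSplitting hmin hT).IsEdgeFold T := by
  have hR : F.R = fun a b => ∃ (γ : G) (k : ℤ), a = γ • F.u ∧ b = (γ * w ^ k) • F.u := by
    funext a b
    refine propext ⟨?_, ?_⟩
    · rintro ⟨γ, h, hh, rfl, rfl⟩
      rw [hw] at hh
      obtain ⟨k, rfl⟩ := hh
      exact ⟨γ, k, rfl, rfl⟩
    · rintro ⟨γ, k, rfl, rfl⟩
      exact ⟨γ, w ^ k, hw ▸ Subgroup.zpow_mem_zpowers w k, rfl, rfl⟩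
  refine ⟨(F.toSplitting_isOneEdgeFree hmin hT).2, F.p, F.u, w, S.f, F.adj,
    F.smul_p w (hw ▸ Subgroup.mem_zpowers w), S.map_smul, S.surjective, fun x y => ?_,
    fun p q => ⟨fun hpq => ?_, ?_⟩⟩
  · have h1 : S.f x = S.f y ↔ Relation.EqvGen F.R x y :=
      ⟨F.eqvGen_of_f_eq hmin hT, F.f_eq_of_eqvGen⟩
    rw [hR] at h1
    exact h1
  · obtain ⟨γ, hγ⟩ := T.exists_smul_of_numEdges hT (S.map_adj _ _ F.adj) hpq
    have hadj := S.adj_smul γ _ _ F.adj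
    rw [← S.map_smul, ← S.map_smul] at hγ
    rcases Sym2.eq_iff.1 hγ with ⟨h1, h2⟩ | ⟨h1, h2⟩
    · exact ⟨γ • F.p, γ • F.u, hadj, h1, h2⟩
    · exact ⟨γ • F.u, γ • F.p, hadj.symm, h2, h1⟩
  · rintro ⟨x, y, hxy, rfl, rfl⟩
    exact S.map_adj _ _ hxy

end FoldEdge

/-! ### Existence of a fold edge in a minimal resolution -/

theorem exists_adj (hT : T.numEdges = 1) : ∃ x y, S.graph.Adj x y := by
  obtain ⟨p, q, hpq⟩ := T.exists_adj_of_numEdges hT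
  obtain ⟨x, rfl⟩ := S.surjective p
  obtain ⟨y, rfl⟩ := S.surjective q
  have : Nontrivial S.V := ⟨x, y, fun h => hpq.ne (congrArg S.f h)⟩
  exact ⟨x, S.isTree.connected.preconnected.exists_adj_of_nontrivial x⟩

theorem exists_generator (hcyc : T.IsCyclic) {p q : T.V} (hpq : T.graph.Adj p q) :
    ∃ w : G, w ≠ 1 ∧ T.edgeStabilizer p q = Subgroup.zpowers w := by
  obtain ⟨e⟩ := hcyc p q hpq
  have := e.isCyclic.2 inferInstance
  obtain ⟨w, hw⟩ := (Subgroup.isCyclic_iff_exists_zpowers_eq_top _).1 this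
  refine ⟨w, ?_, hw.symm⟩
  rintro rfl
  rw [Subgroup.zpowers_one_eq_bot] at hw
  rw [← hw] at e
  have h1 : e.symm (Multiplicative.ofAdd 1) = e.symm 1 := Subsingleton.elim _ _
  simpa using e.symm.injective h1

theorem exists_foldEdge (hmin : ∀ S' : Resolution T, S.reps.card ≤ S'.reps.card)
    (hT : T.numEdges = 1) (hcyc : T.IsCyclic) : Nonempty S.FoldEdge := by
  obtain ⟨v, u₁, u₂, h₁, h₂, hf, hne⟩ : ∃ v u₁ u₂, S.graph.Adj v u₁ ∧ S.graph.Adj v u₂ ∧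
      S.f u₁ = S.f u₂ ∧ u₁ ≠ u₂ := by
    by_contra! hinj
    have hf := S.isTree.connected.injective_of_locally_injective T.isTree.isAcyclic
      ⟨S.f, fun {a b} h => S.map_adj a b h⟩ fun x y z h1 h2 h3 => hinj x y z h1 h2 h3
    obtain ⟨x, y, hxy⟩ := S.exists_adj hT
    obtain ⟨w, hw1, hw⟩ := exists_generator hcyc (S.map_adj x y hxy)
    obtain ⟨i1, i2⟩ := T.mem_edgeStabilizer.1 (hw ▸ Subgroup.mem_zpowers w)
    rw [← S.map_smul] at i1 i2
    exact hw1 (S.free w x y hxy (hf i1) (hf i2))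
  -- Edges at `v` with the same image and in distinct orbits could be folded, against minimality.
  obtain ⟨g, hgv, rfl⟩ : ∃ g : G, g • v = v ∧ g • u₁ = u₂ := by
    by_contra! hno
    obtain ⟨S', hS'⟩ := S.exists_fold h₁ h₂ hf hno
    exact (hmin S').not_gt hS'
  obtain ⟨w, -, hw⟩ := exists_generator hcyc (S.map_adj _ _ h₁)
  have hg : g ∈ T.edgeStabilizer (S.f v) (S.f u₁) :=
    T.mem_edgeStabilizer.2 ⟨by rw [← S.map_smul, hgv], by rw [← S.map_smul, ← hf]⟩
  refine ⟨⟨v, u₁, h₁, fun c hc => ?_⟩⟩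
  rw [hw] at hc hg
  obtain ⟨k, rfl⟩ := hc
  obtain ⟨l, rfl⟩ := hg
  by_contra hcv
  -- Here `g = w ^ l` is nontrivial and commutes with `w ^ k`, so it fixes both `v` and `w ^ k • v`.
  -- These must coincide, so the whole edge stabilizer fixes `v`.
  have h1 : w ^ l • (w ^ k • v) = w ^ k • v := by
    have hcomm : w ^ l * w ^ k = w ^ k * w ^ l := ((Commute.refl w).zpow_zpow l k)
    rw [← mul_smul, hcomm, mul_smul]
    exact congrArg _ hgv
  have h2 := S.eq_one_of_fixed h1 hgv hcv
  exact hne (by simp only [h2, one_smul])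

/-- A one-edge `ℤ`-splitting that has a resolution is an edge fold of a one-edge free splitting. -/
theorem exists_isEdgeFold (S₀ : Resolution T) (hT : T.IsOneEdgeCyclic) :
    ∃ X : Splitting G, X.IsOneEdgeFree ∧ X.IsEdgeFold T := by
  classical
  obtain ⟨S, hmin⟩ : ∃ S : Resolution T, ∀ S' : Resolution T, S.reps.card ≤ S'.reps.card := by
    have hne : ∃ m, ∃ S : Resolution T, S.reps.card = m := ⟨_, S₀, rfl⟩
    obtain ⟨S, hS⟩ := Nat.find_spec hne
    exact ⟨S, fun S' => hS ▸ Nat.find_min' hne ⟨S', rfl⟩⟩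
  obtain ⟨F⟩ := S.exists_foldEdge hmin hT.1 hT.2
  obtain ⟨w, -, hw⟩ := exists_generator hT.2 (S.map_adj _ _ F.adj)
  exact ⟨F.toSplitting hmin hT.1, F.toSplitting_isOneEdgeFree hmin hT.1,
    F.toSplitting_isEdgeFold hmin hT.1 hw⟩

end Resolution

/-! ### The subdivided Cayley tree as a resolution -/

namespace FreeGroup

variable {α : Type}

/-- A function on the edges of the Cayley graph is the coboundary of a function on the vertices. -/
theorem exists_potential (φ : FreeGroup α → α → Bool) :
    ∃ t : FreeGroup α → Bool, ∀ h j, t (h * of j) = (t h ^^ φ h j) := by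
  -- Freeness extends these permutations, which move along an edge and add its value of `φ`, to all
  -- of the group. The opposite group appears because the generators act by right multiplication.
  -- The potential at `g` is the Boolean accumulated from `(1, false)`.
  let σ : α → Equiv.Perm (FreeGroup α × Bool) := fun j =>
    { toFun := fun x => (x.1 * of j, x.2 ^^ φ x.1 j)
      invFun := fun x => (x.1 * (of j)⁻¹, x.2 ^^ φ (x.1 * (of j)⁻¹) j)
      left_inv := fun x => by simp
      right_inv := fun x => by simp }
  let Φ : FreeGroup α →* (Equiv.Perm (FreeGroup α × Bool))ᵐᵒᵖ :=
    lift fun j => MulOpposite.op (σ j)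
  have hof : ∀ j x, (Φ (of j)).unop x = (x.1 * of j, x.2 ^^ φ x.1 j) := fun j x => by
    simp only [Φ, lift_apply_of]
    rfl
  have hmul : ∀ g h x, (Φ (g * h)).unop x = (Φ h).unop ((Φ g).unop x) := fun g h x => by
    rw [_root_.map_mul]
    rfl
  have hfst : ∀ g x, ((Φ g).unop x).1 = x.1 * g := by
    intro g
    induction g using FreeGroup.induction_on with
    | C1 => intro x; simp
    | of j => intro x; rw [hof]
    | inv_of j _ =>
      intro x
      have h1 := hmul (of j)⁻¹ (of j) x
      rw [inv_mul_cancel, hof, _root_.map_one] at h1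
      have h2 := congrArg Prod.fst h1
      exact eq_mul_inv_of_mul_eq h2.symm
    | mul g h ihg ihh => intro x; rw [hmul, ihh, ihg, mul_assoc]
  refine ⟨fun g => ((Φ g).unop (1, false)).2, fun h j => ?_⟩
  simp only [hmul, hof, hfst, one_mul]

end FreeGroup

/-- The vertices of the Cayley tree of a free group, in which the edges labelled `i` are subdivided
into `L i` edges. -/
@[ext] structure CayleyVertex {α : Type} (L : α → ℕ) : Type where
  base : FreeGroup α
  offset : Option (Σ i, {k : ℕ // 0 < k ∧ k < L i})

namespace CayleyVertex

variable {α : Type} {L : α → ℕ}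

instance : MulAction (FreeGroup α) (CayleyVertex L) where
  smul g x := ⟨g * x.base, x.offset⟩
  one_smul x := CayleyVertex.ext (one_mul x.base) rfl
  mul_smul g h x := CayleyVertex.ext (mul_assoc g h x.base) rfl

theorem smul_eq_self {g : FreeGroup α} {x : CayleyVertex L} (h : g • x = x) : g = 1 :=
  mul_eq_right.1 (congrArg base h)

/-- The `k`-th vertex on the edge path from `g` to `g * of i`. -/
def point (L : α → ℕ) (g : FreeGroup α) (i : α) (k : ℕ) : CayleyVertex L :=
  if h : 0 < k ∧ k < L i then ⟨g, some ⟨i, k, h⟩⟩ else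
    if k = 0 then ⟨g, none⟩ else ⟨g * FreeGroup.of i, none⟩

theorem smul_point (h g : FreeGroup α) (i : α) (k : ℕ) :
    h • point L g i k = point L (h * g) i k := by
  unfold point
  split_ifs
  · rfl
  · rfl
  · exact CayleyVertex.ext (mul_assoc h g _).symm rfl

/-- A function on the vertices, given by its values along the subdivided edges. -/
theorem apply_point {β : Type*} (F : CayleyVertex L → β) (F' : FreeGroup α → α → ℕ → β)
    (h0 : ∀ g i, F ⟨g, none⟩ = F' g i 0)
    (hk : ∀ g i k h, F ⟨g, some ⟨i, k, h⟩⟩ = F' g i k)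
    (hL : ∀ g i, F ⟨g * FreeGroup.of i, none⟩ = F' g i (L i)) {g : FreeGroup α} {i : α} {k : ℕ}
    (hkL : k ≤ L i) : F (point L g i k) = F' g i k := by
  unfold point
  split_ifs with h1 h2
  · exact hk g i k h1
  · rw [h2, h0 g i]
  · have : k = L i := by omega
    rw [hL, this]

end CayleyVertex

namespace Splitting

open CayleyVertex

variable {α : Type} (T : Splitting (FreeGroup α)) {v : T.V}
  (p : ∀ i : α, T.graph.Walk v (FreeGroup.of i • v))

/-- The map from the subdivided Cayley tree given by walks from `v` to its translates by the
generators. -/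
def cayleyMap (x : CayleyVertex fun i => (p i).length) : T.V :=
  x.base • x.offset.elim v fun y => (p y.1).getVert y.2

theorem cayleyMap_point {g : FreeGroup α} {i : α} {k : ℕ} (hk : k ≤ (p i).length) :
    T.cayleyMap p (point (fun i => (p i).length) g i k) = g • (p i).getVert k := by
  refine apply_point (T.cayleyMap p) (fun g i k => g • (p i).getVert k) ?_ ?_ ?_ hk
  · intro g i
    simp [cayleyMap]
  · intro g i k h
    rfl
  · intro g i
    simp [cayleyMap, mul_smul]

theorem adj_cayleyMap {g : FreeGroup α} {i : α} {k : ℕ} (hk : k < (p i).length) :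
    T.graph.Adj (T.cayleyMap p (point (fun i => (p i).length) g i k))
      (T.cayleyMap p (point (fun i => (p i).length) g i (k + 1))) := by
  rw [cayleyMap_point _ _ hk.le, cayleyMap_point _ _ hk]
  exact T.adj_smul g _ _ ((p i).adj_getVert_succ hk)

/-- The subdivided Cayley tree. -/
def cayleyGraph : SimpleGraph (CayleyVertex fun i => (p i).length) where
  Adj x y := ∃ g i k, k < (p i).length ∧
    s(point (fun i => (p i).length) g i k, point (fun i => (p i).length) g i (k + 1)) = s(x, y)
  symm := ⟨fun _ _ ⟨g, i, k, hk, h⟩ => ⟨g, i, k, hk, h.trans Sym2.eq_swap⟩⟩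
  loopless := ⟨fun x ⟨g, i, k, hk, h⟩ => by
    have h1 : point (fun i => (p i).length) g i k = x ∧
        point (fun i => (p i).length) g i (k + 1) = x := by simpa using h
    have := T.adj_cayleyMap p (g := g) hk
    rw [h1.1, h1.2] at this
    exact this.ne rfl⟩

theorem cayleyGraph_adj_point {g : FreeGroup α} {i : α} {k : ℕ} (hk : k < (p i).length) :
    (T.cayleyGraph p).Adj (point (fun i => (p i).length) g i k)
      (point (fun i => (p i).length) g i (k + 1)) :=
  ⟨g, i, k, hk, rfl⟩

theorem cayleyGraph_reachable {g : FreeGroup α} {i : α} {k : ℕ} (hk : k ≤ (p i).length) :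
    (T.cayleyGraph p).Reachable (point _ g i 0) (point _ g i k) := by
  induction k with
  | zero => exact SimpleGraph.Reachable.refl _
  | succ k ih => exact (ih (by omega)).trans (T.cayleyGraph_adj_point p (by omega)).reachable

theorem cayleyGraph_connected (hp : ∀ i, 0 < (p i).length) : (T.cayleyGraph p).Connected := by
  have h0 : ∀ g i, point (fun i => (p i).length) g i 0 = ⟨g, none⟩ := fun g i => by simp [point]
  have hL : ∀ g i, point (fun i => (p i).length) g i (p i).length = ⟨g * FreeGroup.of i, none⟩ :=
    fun g i => by simp [point, (hp i).ne']
  have hstep : ∀ g i, (T.cayleyGraph p).Reachable ⟨g, none⟩ ⟨g * FreeGroup.of i, none⟩ := by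
    intro g i
    have := T.cayleyGraph_reachable p (g := g) (i := i) le_rfl
    rwa [h0, hL] at this
  have hnone : ∀ h g : FreeGroup α, (T.cayleyGraph p).Reachable ⟨g, none⟩ ⟨g * h, none⟩ := by
    intro h
    induction h using FreeGroup.induction_on with
    | C1 => intro g; rw [mul_one]
    | of i => exact fun g => hstep g i
    | inv_of i _ =>
      intro g
      have := hstep (g * (FreeGroup.of i)⁻¹) i
      rw [inv_mul_cancel_right] at this
      exact this.symm
    | mul h k ihh ihk =>
      intro g
      rw [← mul_assoc]
      exact (ihh g).trans (ihk _)
  have hall : ∀ x, (T.cayleyGraph p).Reachable ⟨1, none⟩ x := by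
    rintro ⟨g, _ | ⟨i, k, hk⟩⟩
    · simpa using hnone g 1
    · have h1 := T.cayleyGraph_reachable p (g := g) (i := i) hk.2.le
      rw [h0] at h1
      have h2 : point (fun i => (p i).length) g i k = ⟨g, some ⟨i, k, hk⟩⟩ := by
        unfold point
        rw [dif_pos hk]
      rw [h2] at h1
      exact (by simpa using hnone g 1 : (T.cayleyGraph p).Reachable ⟨1, none⟩ ⟨g, none⟩).trans h1
  have : Nonempty (CayleyVertex fun i => (p i).length) := ⟨⟨1, none⟩⟩
  exact ⟨fun x y => (hall x).symm.trans (hall y)⟩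

theorem cayleyGraph_isTree (hp : ∀ i, 0 < (p i).length) : (T.cayleyGraph p).IsTree := by
  classical
  refine ⟨T.cayleyGraph_connected p hp, SimpleGraph.IsAcyclic.of_cuts ?_⟩
  rintro x y ⟨g, i, k, hk, h⟩
  -- The potential `t` changes exactly across the Cayley edge `(g, i)`. On the subdivided edge, `χ`
  -- places this change between positions `k` and `k + 1`.
  obtain ⟨t, ht⟩ := FreeGroup.exists_potential fun h j => decide (h = g ∧ j = i)
  let χ : CayleyVertex (fun i => (p i).length) → Bool := fun x =>
    t x.base ^^ x.offset.elim false fun y => decide (x.base = g ∧ y.1 = i ∧ k < y.2)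
  have hχ : ∀ {h j l}, l ≤ (p j).length → χ (point (fun i => (p i).length) h j l) =
      (t h ^^ decide (h = g ∧ j = i ∧ k < l)) := by
    intro h j l hl
    refine apply_point χ (fun h j l => t h ^^ decide (h = g ∧ j = i ∧ k < l)) ?_ ?_ ?_ hl
    · intro h j
      simp [χ]
    · intro h j l hl
      rfl
    · intro h j
      simp only [χ, ht, Option.elim_none, Bool.xor_false]
      congr 2
      refine propext ⟨fun h1 => ⟨h1.1, h1.2, ?_⟩, fun h1 => ⟨h1.1, h1.2.1⟩⟩
      rw [h1.2]
      exact hk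
  have hdiff : ∀ {h j l}, l < (p j).length →
      (χ (point (fun i => (p i).length) h j l) ≠ χ (point (fun i => (p i).length) h j (l + 1)) ↔
        h = g ∧ j = i ∧ l = k) := by
    intro h j l hl
    rw [hχ hl.le, hχ hl]
    by_cases h1 : h = g ∧ j = i
    · obtain ⟨rfl, rfl⟩ := h1
      rcases lt_trichotomy l k with h2 | h2 | h2
      · simp [h2.not_gt, h2.ne, show ¬ k < l + 1 by omega]
      · simp [h2]
      · simp [h2, h2.ne', show k < l + 1 by omega]
    · have h2 : ∀ P : Prop, ¬ (h = g ∧ j = i ∧ P) := fun P h3 => h1 ⟨h3.1, h3.2.1⟩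
      simp [h2]
  refine ⟨χ, ?_, ?_⟩
  · have h1 := (hdiff hk).2 ⟨rfl, rfl, rfl⟩
    rcases Sym2.eq_iff.1 h with ⟨rfl, rfl⟩ | ⟨rfl, rfl⟩
    · exact h1
    · exact h1.symm
  · rintro x' y' ⟨g', i', k', hk', h'⟩ hne
    have h1 : χ (point (fun i => (p i).length) g' i' k') ≠
        χ (point (fun i => (p i).length) g' i' (k' + 1)) := by
      rcases Sym2.eq_iff.1 h' with ⟨rfl, rfl⟩ | ⟨rfl, rfl⟩
      · exact hne
      · exact hne.symm
    obtain ⟨rfl, rfl, rfl⟩ := (hdiff hk').1 h1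
    rw [← h, ← h']

open Classical in
/-- The subdivided Cayley tree as a resolution. -/
noncomputable def cayleyResolution [Fintype α] (hp : ∀ i, 0 < (p i).length) : Resolution T where
  V := CayleyVertex fun i => (p i).length
  graph := T.cayleyGraph p
  action := inferInstance
  isTree := T.cayleyGraph_isTree p hp
  adj_smul := by
    rintro h x y ⟨g, i, k, hk, e⟩
    refine ⟨h * g, i, k, hk, ?_⟩
    rw [← smul_point, ← smul_point]
    exact congrArg (Sym2.map fun z => h • z) e
  f := T.cayleyMap p
  map_smul g x := mul_smul g x.base _
  map_adj := by
    rintro x y ⟨g, i, k, hk, e⟩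
    have h1 := T.adj_cayleyMap p (g := g) hk
    rcases Sym2.eq_iff.1 e with ⟨rfl, rfl⟩ | ⟨rfl, rfl⟩
    · exact h1
    · exact h1.symm
  free g x y _ hx _ := smul_eq_self hx
  reps :=
    (Finset.univ.sigma fun i : α => Finset.range (p i).length).image fun z =>
      (point _ 1 z.1 z.2, point _ 1 z.1 (z.2 + 1))
  exists_rep := by
    rintro x y ⟨g, i, k, hk, e⟩
    refine ⟨_, Finset.mem_image.2 ⟨⟨i, k⟩, by simpa using hk, rfl⟩, g, ?_⟩
    simpa only [smul_point, mul_one] using e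

/-- Every splitting of a free group of finite rank with an edge has a resolution. -/
theorem exists_resolution [Fintype α] {x y : T.V} (hxy : T.graph.Adj x y) :
    Nonempty (Resolution T) := by
  -- A generator may fix `x`. Starting with the edge to `y` keeps the length positive, so that no
  -- Cayley edge disappears.
  have hw : ∀ i : α, ∃ q : T.graph.Walk x (FreeGroup.of i • x), 0 < q.length := fun i => by
    obtain ⟨q⟩ := T.isTree.connected y (FreeGroup.of i • x)
    exact ⟨SimpleGraph.Walk.cons hxy q, Nat.succ_pos _⟩
  choose p hp using hw
  exact ⟨T.cayleyResolution p hp⟩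

/-- Every one-edge `ℤ`-splitting of a free group of finite rank is an edge fold of a one-edge free
splitting. -/
theorem exists_isEdgeFold [Fintype α] (hT : T.IsOneEdgeCyclic) :
    ∃ X : Splitting (FreeGroup α), X.IsOneEdgeFree ∧ X.IsEdgeFold T := by
  obtain ⟨x, y, hxy⟩ := T.exists_adj_of_numEdges hT.1
  obtain ⟨S⟩ := T.exists_resolution hxy
  exact S.exists_isEdgeFold hT

end Splitting

/-! ### Invariance under equivalence, and trivial folds -/

namespace Splitting

variable {G : Type} [Group G]

theorem edgeStabilizer_equivalent {T T' : Splitting G} (f : T.graph ≃g T'.graph)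
    (hf : ∀ (g : G) (x : T.V), f (g • x) = g • f x) (x y : T.V) :
    T'.edgeStabilizer (f x) (f y) = T.edgeStabilizer x y := by
  ext g
  simp only [mem_edgeStabilizer, ← hf, f.injective.eq_iff]

theorem Equivalent.isFree {T T' : Splitting G} (h : T.Equivalent T') (hT : T.IsFree) :
    T'.IsFree := by
  obtain ⟨f, hf⟩ := h
  intro x y hxy
  obtain ⟨x, rfl⟩ := f.surjective x
  obtain ⟨y, rfl⟩ := f.surjective y
  rw [edgeStabilizer_equivalent f hf]
  exact hT x y (f.map_adj_iff.1 hxy)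

theorem Equivalent.isCyclic {T T' : Splitting G} (h : T.Equivalent T') (hT : T.IsCyclic) :
    T'.IsCyclic := by
  obtain ⟨f, hf⟩ := h
  intro x y hxy
  obtain ⟨x, rfl⟩ := f.surjective x
  obtain ⟨y, rfl⟩ := f.surjective y
  rw [edgeStabilizer_equivalent f hf]
  exact hT x y (f.map_adj_iff.1 hxy)

theorem Equivalent.numEdges_eq_one {T T' : Splitting G} (h : T.Equivalent T')
    (hT : T.numEdges = 1) : T'.numEdges = 1 := by
  obtain ⟨f, hf⟩ := h
  obtain ⟨x, y, hxy⟩ := T.exists_adj_of_numEdges hT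
  refine Splitting.numEdges_eq_one T' (f.map_adj_iff.2 hxy) fun x' y' hxy' => ?_
  obtain ⟨x', rfl⟩ := f.surjective x'
  obtain ⟨y', rfl⟩ := f.surjective y'
  obtain ⟨g, hg⟩ := T.exists_smul_of_numEdges hT hxy (f.map_adj_iff.1 hxy')
  refine ⟨g, ?_⟩
  rw [← hf, ← hf]
  exact congrArg (Sym2.map f) hg

theorem IsEdgeFold.trans_equivalent {S T T' : Splitting G} (h : S.IsEdgeFold T)
    (hT : T.Equivalent T') : S.IsEdgeFold T' := by
  obtain ⟨hfree, v, u, w, f, hvu, hw, hf, hsurj, hrel, hadj⟩ := h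
  obtain ⟨k, hk⟩ := hT
  refine ⟨hfree, v, u, w, k ∘ f, hvu, hw, fun g x => ?_, k.surjective.comp hsurj, fun x y => ?_,
    fun p q => ?_⟩
  · simp only [Function.comp_apply, hf, hk]
  · rw [← hrel]
    exact k.injective.eq_iff
  · obtain ⟨p, rfl⟩ := k.surjective p
    obtain ⟨q, rfl⟩ := k.surjective q
    refine k.map_adj_iff.trans ((hadj p q).trans ?_)
    simp only [Function.comp_apply, k.injective.eq_iff]

/-- An edge fold between free splittings is trivial. -/
theorem IsEdgeFold.equivalent {S T : Splitting G} (h : S.IsEdgeFold T) (hT : T.IsFree) :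
    S.Equivalent T := by
  obtain ⟨-, v, u, w, f, hvu, hw, hf, hsurj, hrel, hadj⟩ := h
  -- The folding element fixes the image of the folded edge, and edge stabilizers of `T` are
  -- trivial.
  have hw1 : w = 1 := by
    have h1 : w ∈ T.edgeStabilizer (f v) (f u) := by
      refine T.mem_edgeStabilizer.2 ⟨by rw [← hf, mem_stabilizer_iff.1 hw], ?_⟩
      rw [← hf, eq_comm, hrel]
      exact Relation.EqvGen.rel _ _ ⟨1, 1, by simp, by simp⟩
    rwa [hT _ _ ((hadj _ _).2 ⟨v, u, hvu, rfl, rfl⟩), Subgroup.mem_bot] at h1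
  have hinj : Function.Injective f := by
    intro x y hxy
    rw [hrel] at hxy
    induction hxy with
    | rel _ _ h =>
      obtain ⟨γ, k, rfl, rfl⟩ := h
      rw [hw1, one_zpow, mul_one]
    | refl => rfl
    | symm _ _ _ ih => exact ih.symm
    | trans _ _ _ _ _ ih1 ih2 => exact ih1.trans ih2
  refine ⟨⟨Equiv.ofBijective f ⟨hinj, hsurj⟩, fun {x y} => ?_⟩, hf⟩
  refine (hadj (f x) (f y)).trans ⟨?_, fun h => ⟨x, y, h, rfl, rfl⟩⟩
  rintro ⟨x', y', h, hx, hy⟩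
  rwa [← hinj hx, ← hinj hy]

end Splitting

namespace SplittingClass

variable {G : Type} [Group G]

theorem IsOneEdgeFree.of_toClass {T : Splitting G} (h : IsOneEdgeFree T.toClass) :
    T.IsOneEdgeFree := by
  obtain ⟨S, hS, h⟩ := h
  have hST : S.Equivalent T := Quotient.exact hS
  exact ⟨hST.numEdges_eq_one h.1, hST.isFree h.2⟩

theorem IsOneEdgeCyclic.of_toClass {T : Splitting G} (h : IsOneEdgeCyclic T.toClass) :
    T.IsOneEdgeCyclic := by
  obtain ⟨S, hS, h⟩ := h
  have hST : S.Equivalent T := Quotient.exact hS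
  exact ⟨hST.numEdges_eq_one h.1, hST.isCyclic h.2⟩

end SplittingClass

theorem Splitting.IsOneEdgeCyclic.not_isFree {G : Type} [Group G] {T : Splitting G}
    (h : T.IsOneEdgeCyclic) : ¬ T.IsFree := by
  intro hfree
  obtain ⟨x, y, hxy⟩ := T.exists_adj_of_numEdges h.1
  obtain ⟨w, hw1, hw⟩ := Resolution.exists_generator h.2 hxy
  have h1 : w ∈ T.edgeStabilizer x y := hw ▸ Subgroup.mem_zpowers w
  rw [hfree x y hxy] at h1
  exact hw1 (Subgroup.mem_bot.1 h1)

/-! ### Comparison of the path metrics -/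

namespace FZVertex

variable {G : Type} [Group G]

/-- The inclusion of vertex sets. -/
def toBar (X : FZVertex G) : FZBarVertex G := ⟨X.1, Or.inl X.2⟩

theorem toBar_injective : Function.Injective (toBar (G := G)) := fun _ _ h =>
  Subtype.ext (congrArg (fun Z : FZBarVertex G => Z.1) h)

theorem not_isOneEdgeCyclic (X : FZVertex G) : ¬ X.1.IsOneEdgeCyclic := by
  rintro ⟨T, hT, h⟩
  have h1 := X.2
  rw [← hT] at h1
  exact h.not_isFree h1.of_toClass.2

theorem exists_isEdgeFold_of_adj {X : FZVertex G} {Z : FZBarVertex G}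
    (hZ : Z.1.IsOneEdgeCyclic) (h : (FZBar G).Adj X.toBar Z) :
    ∃ S T : Splitting G, S.toClass = X.1 ∧ T.toClass = Z.1 ∧ S.IsEdgeFold T := by
  rcases h.2 with ⟨S, T, hS, hT, ⟨-, hfree, -⟩ | hfold⟩ | ⟨T, S, hT, hS, ⟨hfree, -⟩ | hfold⟩
  · rw [← hT] at hZ
    exact absurd hfree.2 hZ.of_toClass.not_isFree
  · exact ⟨S, T, hS, hT, hfold⟩
  · rw [← hT] at hZ
    exact absurd hfree.2 hZ.of_toClass.not_isFree
  · rw [← hT] at hZ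
    exact absurd hfold.1 hZ.of_toClass.not_isFree

/-- Only common refinements contribute: a fold between free splittings is an equivalence, which
distinctness rules out. -/
theorem adj_of_toBar_adj {X Y : FZVertex G} (h : (FZBar G).Adj X.toBar Y.toBar) :
    (FZ G).Adj X Y := by
  have hfold : ∀ {X Y : FZVertex G} {S T : Splitting G}, S.toClass = X.1 → T.toClass = Y.1 →
      S.IsEdgeFold T → X = Y := by
    intro X Y S T hS hT hfold
    have hY := Y.2
    rw [← hT] at hY
    exact Subtype.ext (hS.symm.trans
      ((Quotient.sound (hfold.equivalent hY.of_toClass.2)).trans hT))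
  have hne : X ≠ Y := fun e => h.1 (congrArg toBar e)
  refine ⟨hne, ?_⟩
  rcases h.2 with ⟨S, T, hS, hT, ⟨-, -, hR⟩ | h'⟩ | ⟨S, T, hS, hT, ⟨-, -, hR⟩ | h'⟩
  · exact Or.inl ⟨S, T, hS, hT, Or.inl hR⟩
  · exact absurd (hfold hS hT h') hne
  · exact Or.inr ⟨S, T, hS, hT, Or.inl hR⟩
  · exact absurd (hfold hS hT h').symm hne

theorem eq_or_adj_of_toBar_adj {X Y : FZVertex G} {Z : FZBarVertex G}
    (hZ : Z.1.IsOneEdgeCyclic) (hX : (FZBar G).Adj X.toBar Z) (hY : (FZBar G).Adj Y.toBar Z) :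
    X = Y ∨ (FZ G).Adj X Y := by
  obtain ⟨S, T, hS, hT, hST⟩ := exists_isEdgeFold_of_adj hZ hX
  obtain ⟨S', T', hS', hT', hST'⟩ := exists_isEdgeFold_of_adj hZ hY
  have hTT : T'.Equivalent T := Quotient.exact (hT'.trans hT.symm)
  rw [← hT] at hZ
  refine or_iff_not_imp_left.2 fun hne => ⟨hne, Or.inl ⟨S, S', hS, hS', Or.inr ⟨T, hZ.of_toClass,
    hST, hST'.trans_equivalent hTT⟩⟩⟩

theorem edist_le_of_walk (m : ℕ) : ∀ {X Y : FZVertex G} (w : (FZBar G).Walk X.toBar Y.toBar),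
    w.length ≤ m → (FZ G).edist X Y ≤ w.length := by
  induction m using Nat.strong_induction_on with | _ m ih
  intro X Y w hw
  -- Endpoints are generalized so that the walk can be destructed. A first step to a free vertex
  -- stays a step; a first step to a `ℤ`-vertex is merged with the next one, which must lead back to
  -- a free vertex because folds start at free splittings.
  have key : ∀ {A B : FZBarVertex G} (w : (FZBar G).Walk A B), A = X.toBar → B = Y.toBar →
      w.length ≤ m → (FZ G).edist X Y ≤ w.length := by
    intro A B w hA hB hw
    have step : ∀ {X' : FZVertex G} {k : ℕ}, (FZ G).edist X X' ≤ 1 →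
        (FZ G).edist X' Y ≤ k → (FZ G).edist X Y ≤ ((k + 1 : ℕ) : ℕ∞) := by
      intro X' k h1 h2
      refine SimpleGraph.edist_triangle.trans ((add_le_add h1 h2).trans ?_)
      rw [Nat.cast_add, Nat.cast_one, add_comm]
    cases w with
    | nil =>
      rw [toBar_injective (hA.symm.trans hB)]
      simp
    | @cons _ Z _ h w =>
      subst hA
      rw [SimpleGraph.Walk.length_cons] at hw ⊢
      rcases Z.2 with hZ | hZ
      · obtain ⟨Z, rfl⟩ : ∃ Z' : FZVertex G, Z'.toBar = Z := ⟨⟨Z.1, hZ⟩, rfl⟩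
        subst hB
        exact step (SimpleGraph.edist_le_one_iff_adj_or_eq.2 (Or.inl (adj_of_toBar_adj h)))
          (ih w.length (by omega) w le_rfl)
      · cases w with
        | nil =>
          rw [hB] at hZ
          exact absurd hZ Y.not_isOneEdgeCyclic
        | @cons _ Z' _ h' w =>
          rw [SimpleGraph.Walk.length_cons] at hw ⊢
          subst hB
          rcases Z'.2 with hZ' | hZ'
          · obtain ⟨Z', rfl⟩ : ∃ Z'' : FZVertex G, Z''.toBar = Z' := ⟨⟨Z'.1, hZ'⟩, rfl⟩
            have h1 := eq_or_adj_of_toBar_adj hZ h h'.symm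
            refine (step (SimpleGraph.edist_le_one_iff_adj_or_eq.2 h1.symm)
              (ih w.length (by omega) w le_rfl)).trans ?_
            exact_mod_cast Nat.le_succ _
          · exfalso
            rcases h'.2 with ⟨S, T, hS, hT, ⟨hfree, -⟩ | hfold⟩ |
              ⟨S, T, hS, hT, ⟨hfree, -⟩ | hfold⟩
            · rw [← hS] at hZ
              exact hZ.of_toClass.not_isFree hfree.2
            · rw [← hS] at hZ
              exact hZ.of_toClass.not_isFree hfold.1
            · rw [← hS] at hZ'
              exact hZ'.of_toClass.not_isFree hfree.2
            · rw [← hS] at hZ'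
              exact hZ'.of_toClass.not_isFree hfold.1
  exact key w rfl rfl hw

theorem edist_le_edist_toBar (X Y : FZVertex G) :
    (FZ G).edist X Y ≤ (FZBar G).edist X.toBar Y.toBar := by
  by_cases h : (FZBar G).edist X.toBar Y.toBar = ⊤
  · rw [h]
    exact le_top
  · obtain ⟨w, hw⟩ := SimpleGraph.exists_walk_of_edist_ne_top h
    rw [← hw]
    exact edist_le_of_walk _ w le_rfl

theorem edist_toBar_le_one_of_isEdgeFold {X : FZVertex G} {Z : FZBarVertex G} {S T : Splitting G}
    (hS : S.toClass = X.1) (hT : T.toClass = Z.1) (h : S.IsEdgeFold T) :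
    (FZBar G).edist X.toBar Z ≤ 1 := by
  rw [SimpleGraph.edist_le_one_iff_adj_or_eq, or_iff_not_imp_right]
  exact fun hne => ⟨hne, Or.inl ⟨S, T, hS, hT, Or.inr h⟩⟩

theorem edist_toBar_le_two_of_adj {X Y : FZVertex G} (h : (FZ G).Adj X Y) :
    (FZBar G).edist X.toBar Y.toBar ≤ 2 := by
  have key : ∀ {X Y : FZVertex G} {S T : Splitting G}, X ≠ Y → S.toClass = X.1 →
      T.toClass = Y.1 → (S.HaveCommonRefinement T ∨
        ∃ R : Splitting G, R.IsOneEdgeCyclic ∧ S.IsEdgeFold R ∧ T.IsEdgeFold R) →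
      (FZBar G).edist X.toBar Y.toBar ≤ 2 := by
    rintro X Y S T hne hS hT (hR | ⟨R, hR, hSR, hTR⟩)
    · have hX := X.2
      have hY := Y.2
      rw [← hS] at hX
      rw [← hT] at hY
      have hadj : (FZBar G).Adj X.toBar Y.toBar := ⟨fun h => hne (toBar_injective h),
        Or.inl ⟨S, T, hS, hT, Or.inl ⟨hX.of_toClass, hY.of_toClass, hR⟩⟩⟩
      exact (SimpleGraph.edist_le_one_iff_adj_or_eq.2 (Or.inl hadj)).trans (by norm_num)
    · let Z : FZBarVertex G := ⟨R.toClass, Or.inr ⟨R, rfl, hR⟩⟩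
      have h1 := edist_toBar_le_one_of_isEdgeFold (Z := Z) hS rfl hSR
      have h2 := edist_toBar_le_one_of_isEdgeFold (Z := Z) hT rfl hTR
      rw [SimpleGraph.edist_comm] at h2
      refine SimpleGraph.edist_triangle.trans ((add_le_add h1 h2).trans ?_)
      norm_num
  rcases h with ⟨hne, ⟨S, T, hS, hT, h⟩ | ⟨S, T, hS, hT, h⟩⟩
  · exact key hne hS hT h
  · rw [SimpleGraph.edist_comm]
    exact key hne.symm hS hT h

theorem edist_toBar_le (X Y : FZVertex G) :
    (FZBar G).edist X.toBar Y.toBar ≤ 2 * (FZ G).edist X Y := by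
  by_cases h : (FZ G).edist X Y = ⊤
  · rw [h, ENat.mul_top (by norm_num)]
    exact le_top
  · obtain ⟨w, hw⟩ := SimpleGraph.exists_walk_of_edist_ne_top h
    rw [← hw]
    clear hw h
    induction w with
    | nil => simp
    | cons h w ih =>
      refine SimpleGraph.edist_triangle.trans
        ((add_le_add (edist_toBar_le_two_of_adj h) ih).trans (le_of_eq ?_))
      rw [SimpleGraph.Walk.length_cons]
      push_cast
      ring

end FZVertex

theorem proposition1 (n : ℕ) :
    ∃ f : FZVertex (FreeGroup (Fin n)) → FZBarVertex (FreeGroup (Fin n)),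
      (∀ (a : Out (FreeGroup (Fin n))) (X : FZVertex (FreeGroup (Fin n))), f (a • X) = a • f X) ∧
      IsQuasiIsometry (FZ (FreeGroup (Fin n))) (FZBar (FreeGroup (Fin n))) f := by
  -- The factor 2 is the detour through a `ℤ`-splitting; the additive constant 1 is needed only for
  -- coarse surjectivity.
  refine ⟨FZVertex.toBar, fun _ _ => rfl, 2, 1, by norm_num, fun X Y => ?_, fun X Y => ?_,
    fun Z => ?_⟩
  · exact (FZVertex.edist_toBar_le X Y).trans le_self_add
  · refine (FZVertex.edist_le_edist_toBar X Y).trans (le_trans ?_ le_self_add)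
    exact le_mul_of_one_le_left (zero_le) (by norm_num)
  · suffices h : ∃ X, (FZBar (FreeGroup (Fin n))).edist (FZVertex.toBar X) Z ≤ 1 by
      obtain ⟨X, hX⟩ := h
      exact ⟨X, SimpleGraph.edist_comm.trans_le (by simpa using hX)⟩
    rcases Z.2 with h | h
    · refine ⟨⟨Z.1, h⟩, SimpleGraph.edist_le_one_iff_adj_or_eq.2 (Or.inr rfl)⟩
    · obtain ⟨T, hTZ, hT⟩ := h
      obtain ⟨S, hS, hST⟩ := T.exists_isEdgeFold hT
      exact ⟨⟨S.toClass, S, rfl, hS⟩, FZVertex.edist_toBar_le_one_of_isEdgeFold rfl hTZ hST⟩
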